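/- Let $\mathbb{F}_q$ be a finite field. For a partial order $\mathcal{R}$ on a finite set $A$, let $\mathrm{Int}^\circ(\mathcal{R})$ be the set of intervals $[i,j]$ with $i\prec_{\mathcal{R}} j$, ordered by inclusion, and let $\mathrm{UT}_{\mathcal{R}}$ be the pattern group of all matrices $u$ over $\mathbb{F}_q$, with rows and columns indexed by $A$, such that $u_{ii}=1$ for all $i$ and $u_{ij}=0$ unless $i\preceq_{\mathcal{R}} j$. If $\mathcal{Q}$ is a subposet of $\mathcal{R}$ (a partial order on $A$ contained in $\mathcal{R}$), then $\mathrm{UT}_{\mathcal{Q}}\le \mathrm{UT}_{\mathcal{R}}$; let $\mathrm{NPtt}(\mathcal{R})$ be the set of the subgroups of this form that are normal in $\mathrm{UT}_{\mathcal{R}}$, ordered by inclusion. For $[i,j]\in \mathrm{Int}^\circ(\mathcal{R})$ let $\mathcal{R}_{[i,j]}$ be the subposet with $k\prec l$ if and only if $k\prec_{\mathcal{R}}l$ and $[k,l]\not\subseteq[i,j]$. For a poset $P$ let $\mathrm{Anti}(P)$ be the set of its antichains, and let $\mathrm{pp}_{\mathrm{nn}}(\mathcal{R})=\mathrm{Anti}(\mathrm{Int}^\circ(\mathcal{R}))$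 be the set of non-nesting $\mathcal{R}$-partitions. For $\lambda\in \mathrm{pp}_{\mathrm{nn}}(\mathcal{R})$ put $\mathrm{UT}_\lambda=\bigcap_{[i,j]\in\lambda}\mathrm{UT}_{\mathcal{R}_{[i,j]}}$ (which is $\mathrm{UT}_{\mathcal{R}}$ if $\lambda=\emptyset$), and let $$\chi^\lambda=\sum_{\psi}\psi(1)\,\psi,$$ where $\psi$ runs over the irreducible complex characters of $\mathrm{UT}_{\mathcal{R}}$ whose kernel contains $\mathrm{UT}_\lambda$ but contains no cover of $\mathrm{UT}_\lambda$ in $\mathrm{NPtt}(\mathcal{R})$. Write $\mathrm{f}(G)$ for the space of functions $G\to\mathbb{C}$, and identify $\mathrm{f}(G)\otimes \mathrm{f}(H)$ with $\mathrm{f}(G\times H)$ by $(\chi\otimes\psi)(g,h)=\chi(g)\psi(h)$. Let $A,B$ be finite sets with $A\cap B=\emptyset$. (a) Let $\mathcal{R}$ be a partial order on $A$ and $\mathcal{Q}$ a partial order on $B$. Let $\mathcal{R}.\mathcal{Q}$ be their concatenation, that is, the partial order on $A\cup B$ in which $i\preceq j$ if and only if $i\preceq_{\mathcal{R}}j$,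 or $i\preceq_{\mathcal{Q}}j$, or $i\in A$ and $j\in B$, and let $\mathrm{Inf}_{A,B}:\mathrm{f}(\mathrm{UT}_{\mathcal{R}})\otimes \mathrm{f}(\mathrm{UT}_{\mathcal{Q}})\to \mathrm{f}(\mathrm{UT}_{\mathcal{R}.\mathcal{Q}})$ be the composition with the projection $\mathrm{UT}_{\mathcal{R}.\mathcal{Q}}\to\mathrm{UT}_{\mathcal{R}}\times\mathrm{UT}_{\mathcal{Q}}$ onto the two diagonal blocks. Then for all $\lambda\in\mathrm{pp}_{\mathrm{nn}}(\mathcal{R})$ and $\nu\in\mathrm{pp}_{\mathrm{nn}}(\mathcal{Q})$, $$\mathrm{Inf}_{A,B}(\chi^\lambda\otimes\chi^\nu)=\chi^{\lambda\cup\nu},$$ where $\lambda\cup\nu\in \mathrm{pp}_{\mathrm{nn}}(\mathcal{R}.\mathcal{Q})$. (b) Let $\mathcal{R}$ be a partial order on $A\cup B$, with restrictions $\mathcal{R}|_A$ and $\mathcal{R}|_B$ to $A$ and $B$, and let $\mathrm{Res}_{A,B}:\mathrm{f}(\mathrm{UT}_{\mathcal{R}})\to \mathrm{f}(\mathrm{UT}_{\mathcal{R}|_A})\otimes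 \mathrm{f}(\mathrm{UT}_{\mathcal{R}|_B})$ be the restriction along the block diagonal embedding $\mathrm{UT}_{\mathcal{R}|_A}\times\mathrm{UT}_{\mathcal{R}|_B}\subseteq\mathrm{UT}_{\mathcal{R}}$. Let $\lambda\in\mathrm{pp}_{\mathrm{nn}}(\mathcal{R})$. For $X\in\{A,B\}$ let $\lambda_X\in \mathrm{pp}_{\mathrm{nn}}(\mathcal{R}|_X)$ be the set of the $[i,j]\in\lambda$ with $i,j\in X$, and let $$\mathrm{Int}^\lambda_{\lambda_X}=\Big\{[i,j]\in\mathrm{Int}^\circ(\mathcal{R}|_X)\ \Big|\ i\prec j \text{ in } (\mathcal{R}|_X)_{[k,l]}\text{ for all }[k,l]\in\lambda_X,\text{ but not } i\prec j\text{ in }\mathcal{R}_{[k,l]}\text{ for all }[k,l]\in\lambda\Big\},$$ ordered as a subset of $\mathrm{Int}^\circ(\mathcal{R}|_X)$. Then $$\mathrm{Res}_{A,B}(\chi^{\lambda})=\frac{|\mathrm{UT}_\lambda\cap(\mathrm{UT}_{\mathcal{R}|_A}\times\mathrm{UT}_{\mathcal{R}|_B})|}{|\mathrm{UT}_{\lambda_A}\times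 \mathrm{UT}_{\lambda_B}|}\,\frac{\chi^{\lambda}(1)}{\chi^{\lambda_{A}\cup\lambda_{B}}(1)}\sum_{ \nu\in \mathrm{Anti}(\mathrm{Int}^\lambda_{\lambda_A})\atop \eta\in \mathrm{Anti}(\mathrm{Int}^\lambda_{\lambda_B})} \chi^{\lambda_A\cup\nu}\otimes \chi^{\lambda_B\cup\eta},$$ where $\lambda_A\cup\nu\in \mathrm{pp}_{\mathrm{nn}}(\mathcal{R}|_A)$, $\lambda_B\cup\eta\in\mathrm{pp}_{\mathrm{nn}}(\mathcal{R}|_B)$, and $\chi^{\lambda_A\cup\lambda_B}$ is the supercharacter of $\mathrm{UT}_{\mathcal{R}|_A}\times\mathrm{UT}_{\mathcal{R}|_B}=\mathrm{UT}_{\mathcal{R}|_A\sqcup\mathcal{R}|_B}$ attached to $\lambda_A\cup\lambda_B$, with $\mathcal{R}|_A\sqcup\mathcal{R}|_B$ the partial order on $A\cup B$ in which no element of $A$ is comparable to an element of $B$. -/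

import Mathlib

open scoped TensorProduct

/-! ## Pattern groups -/

namespace PatternGroup

section Groups

variable {A : Type*} [Fintype A] [DecidableEq A]

/-- The matrices `u` with entries in `F`, rows and columns indexed by `A`, such that `u i i = 1`
and `u i j = 0` unless `i ⪯ j` in `R`, that is, the functions on the intervals of `R` that take
the value `1` on the intervals `[i, i]`, extended by zero; the product is the matrix product
`(u v) [i, k] = ∑ u [i, j] v [j, k]`, the sum over `i ⪯ j ⪯ k`. -/
def utSubmonoid (F : Type*) [Field F] (R : PartialOrder A) : Submonoid (Matrix A A F) where
  carrier := {u | (∀ i, u i i = 1) ∧ ∀ i j, ¬ R.le i j → u i j = 0}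
  one_mem' := by
    refine ⟨fun i => Matrix.one_apply_eq i, fun i j h => Matrix.one_apply_ne ?_⟩
    rintro rfl
    exact h (R.le_refl i)
  mul_mem' := by
    rintro u v ⟨hu, hu'⟩ ⟨hv, hv'⟩
    refine ⟨fun i => ?_, fun i k h => ?_⟩
    · rw [Matrix.mul_apply, Finset.sum_eq_single i]
      · rw [hu, hv, one_mul]
      · intro j _ hj
        by_cases h1 : R.le i j
        · by_cases h2 : R.le j i
          · exact absurd (R.le_antisymm _ _ h2 h1) hj
          · rw [hv' _ _ h2, mul_zero]
        · rw [hu' _ _ h1, zero_mul]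
      · intro h
        exact absurd (Finset.mem_univ i) h
    · rw [Matrix.mul_apply]
      refine Finset.sum_eq_zero fun j _ => ?_
      by_cases h1 : R.le i j
      · by_cases h2 : R.le j k
        · exact absurd (R.le_trans _ _ _ h1 h2) h
        · rw [hv' _ _ h2, mul_zero]
      · rw [hu' _ _ h1, zero_mul]

/-- The pattern group `UT_R`. -/
abbrev UT (F : Type*) [Field F] (R : PartialOrder A) : Type _ := utSubmonoid F R

theorem det_eq_one_of_upper {F : Type*} [Field F] (L : LinearOrder A) {u : Matrix A A F}
    (h1 : ∀ i, u i i = 1) (h0 : ∀ i j, j < i → u i j = 0) : u.det = 1 := by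
  have h : u.IsUpperTriangular := fun i j hij => h0 i j hij
  have h2 := Matrix.det_of_isUpperTriangular h
  rw [Finset.prod_eq_one fun i _ => h1 i] at h2
  convert h2

variable {F : Type*} [Field F] {R : PartialOrder A}

theorem det_eq_one {u : Matrix A A F} (hu : u ∈ utSubmonoid F R) : u.det = 1 := by
  obtain ⟨s, hs, hle⟩ := @extend_partialOrder A R.le inferInstance
  let L : LinearOrder A :=
    { le := s
      lt := fun i j => s i j ∧ ¬ s j i
      lt_iff_le_not_ge := fun _ _ => Iff.rfl
      le_refl := hs.refl
      le_trans := hs.trans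
      le_antisymm := hs.antisymm
      le_total := hs.total
      toDecidableLE := Classical.decRel _ }
  exact det_eq_one_of_upper L hu.1 fun i j hij => hu.2 i j fun h' => hij.2 (hle i j h')

variable [Finite F]

theorem inv_mem {u : Matrix A A F} (hu : u ∈ utSubmonoid F R) : u⁻¹ ∈ utSubmonoid F R := by
  have hdet : IsUnit u.det := by
    rw [det_eq_one hu]
    exact isUnit_one
  obtain ⟨w, rfl⟩ := (Matrix.isUnit_iff_isUnit_det u).2 hdet
  rw [← Matrix.coe_units_inv]
  have h1 : w⁻¹ = w ^ (orderOf w - 1) := by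
    rw [inv_eq_iff_mul_eq_one, ← pow_succ',
      Nat.sub_add_cancel (orderOf_pos w), pow_orderOf_eq_one]
  rw [h1, Units.val_pow_eq_pow_val]
  exact Submonoid.pow_mem _ hu _

/-- For a finite field, the pattern group is a group (under matrix inversion). -/
noncomputable instance : Group (UT F R) where
  inv u := ⟨(u : Matrix A A F)⁻¹, inv_mem u.2⟩
  inv_mul_cancel u := Subtype.ext (Matrix.nonsing_inv_mul _ (by
    rw [det_eq_one u.2]
    exact isUnit_one))

/-- For posets `Q` and `R` on `A`, the elements of `UT_R` with support in `Q`. If `Q` is a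
subposet of `R`, this is the subgroup `UT_Q` of `UT_R`. -/
noncomputable def patternSubgroup (F : Type*) [Field F] [Finite F] (R Q : PartialOrder A) :
    Subgroup (UT F R) where
  carrier := {u | (u : Matrix A A F) ∈ utSubmonoid F Q}
  one_mem' := (utSubmonoid F Q).one_mem
  mul_mem' := fun h1 h2 => (utSubmonoid F Q).mul_mem h1 h2
  inv_mem' := fun h => inv_mem h

/-- The set `NPtt(R)` of normal pattern subgroups of `UT_R`. -/
def NPtt (F : Type*) [Field F] [Finite F] (R : PartialOrder A) : Set (Subgroup (UT F R)) :=
  {N | N.Normal ∧ ∃ Q : PartialOrder A, (∀ i j, Q.le i j → R.le i j) ∧ N = patternSubgroup F R Q}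

end Groups

/-! ## Supercharacters of a normal lattice supercharacter theory -/

section Characters

variable {G : Type*} [Group G]

/-- The irreducible complex characters of `G`. -/
def irr (G : Type*) [Group G] : Set (G → ℂ) :=
  {ψ | ∃ (n : ℕ) (ρ : Representation ℂ G (Fin n → ℂ)), ρ.IsIrreducible ∧ ψ = ρ.character}

/-- The kernel of a character. -/
def charKer (ψ : G → ℂ) : Set G := {g | ψ g = ψ 1}

/-- The covers of `M` in the poset `𝓝` of subgroups, ordered by inclusion. -/
def covers (𝓝 : Set (Subgroup G)) (M : Subgroup G) : Set (Subgroup G) :=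
  {L | L ∈ 𝓝 ∧ M < L ∧ ∀ K ∈ 𝓝, M < K → K ≤ L → K = L}

/-- The irreducible characters whose kernel contains `N` but no cover of `N` in `𝓝`. -/
def charBlock (𝓝 : Set (Subgroup G)) (N : Subgroup G) : Set (G → ℂ) :=
  {ψ | ψ ∈ irr G ∧ (N : Set G) ⊆ charKer ψ ∧ ∀ O ∈ covers 𝓝 N, ¬ (O : Set G) ⊆ charKer ψ}

/-- The irreducible characters of a finite group are finite in number, so that the sum below
is an honest finite sum. -/
theorem finite_irr (G : Type*) [Group G] [Finite G] : (irr G).Finite := by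
  classical
  have := Fintype.ofFinite G
  have hcard : (Nat.card G : ℂ) ≠ 0 := Nat.cast_ne_zero.2 Nat.card_pos.ne'
  let _ : Invertible (Nat.card G : ℂ) := invertibleOfNonzero hcard
  have key : ∀ ψ ∈ irr G, ∀ φ ∈ irr G,
      (Nat.card G : ℂ)⁻¹ * ∑ g : G, ψ g * φ g⁻¹ = if ψ = φ then 1 else 0 := by
    rintro ψ ⟨n, ρ, hρ, rfl⟩ φ ⟨m, σ, hσ, rfl⟩
    have := hρ
    have := hσ
    have h := Representation.char_orthonormal ρ σ
    by_cases hiso : Nonempty (Representation.Equiv σ ρ)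
    · have he : ρ.character = σ.character := (Representation.char_iso hiso.some).symm
      rw [h, if_pos hiso, if_pos he]
    · by_cases he : ρ.character = σ.character
      · exfalso
        have h2 := Representation.char_orthonormal ρ ρ
        rw [if_pos ⟨Representation.Equiv.refl ρ⟩] at h2
        rw [if_neg hiso, ← he, h2] at h
        exact one_ne_zero h
      · rw [h, if_neg hiso, if_neg he]
  have hli : LinearIndependent ℂ (fun ψ : irr G => (ψ : G → ℂ)) := by
    rw [linearIndependent_iff']
    intro s c hc φ hφ
    have h : (Nat.card G : ℂ)⁻¹ *
        ∑ g : G, (∑ ψ ∈ s, c ψ • (ψ : G → ℂ)) g * (φ : G → ℂ) g⁻¹ = c φ := by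
      have h1 : ∀ g : G, (∑ ψ ∈ s, c ψ • (ψ : G → ℂ)) g * (φ : G → ℂ) g⁻¹
          = ∑ ψ ∈ s, c ψ * ((ψ : G → ℂ) g * (φ : G → ℂ) g⁻¹) := by
        intro g
        rw [Finset.sum_apply, Finset.sum_mul]
        refine Finset.sum_congr rfl fun ψ _ => ?_
        rw [Pi.smul_apply, smul_eq_mul, mul_assoc]
      rw [Finset.sum_congr rfl fun g _ => h1 g, Finset.sum_comm, Finset.mul_sum]
      rw [Finset.sum_eq_single φ]
      · rw [← Finset.mul_sum, mul_left_comm, key _ φ.2 _ φ.2, if_pos rfl, mul_one]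
      · intro ψ _ hne
        rw [← Finset.mul_sum, mul_left_comm, key _ ψ.2 _ φ.2,
          if_neg (fun h => hne (Subtype.ext h)), mul_zero]
      · exact fun h => absurd hφ h
    rw [hc] at h
    simpa using h.symm
  exact hli.setFinite

/-- The supercharacter attached to a member `N` of the lattice `𝓝`: the sum of `ψ(1) ψ` over the
irreducible characters `ψ` whose kernel contains `N` but no cover of `N` in `𝓝`. -/
noncomputable def superchar (𝓝 : Set (Subgroup G)) (N : Subgroup G) : G → ℂ :=
  ∑ᶠ ψ ∈ charBlock 𝓝 N, ψ 1 • ψ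

end Characters

/-! ## Intervals and non-nesting partitions -/

section Intervals

variable {A C : Type*}

/-- The proper intervals `[i, j]`, `i ≺ j`, of a poset, represented by their endpoints. -/
@[ext]
structure IntO (R : PartialOrder A) where
  /-- the smaller endpoint -/
  left : A
  /-- the larger endpoint -/
  right : A
  /-- the interval is proper -/
  lt : R.lt left right

namespace IntO

/-- The order on proper intervals by inclusion: `[i, j] ⊆ [k, l]` if and only if `k ⪯ i` and
`j ⪯ l`. -/
instance {R : PartialOrder A} : PartialOrder (IntO R) where
  le p q := R.le q.left p.left ∧ R.le p.right q.right
  lt p q := (R.le q.left p.left ∧ R.le p.right q.right) ∧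
    ¬ (R.le p.left q.left ∧ R.le q.right p.right)
  lt_iff_le_not_ge _ _ := Iff.rfl
  le_refl _ := ⟨R.le_refl _, R.le_refl _⟩
  le_trans _ _ _ h1 h2 := ⟨R.le_trans _ _ _ h2.1 h1.1, R.le_trans _ _ _ h1.2 h2.2⟩
  le_antisymm _ _ h1 h2 :=
    IntO.ext (R.le_antisymm _ _ h2.1 h1.1) (R.le_antisymm _ _ h1.2 h2.2)

theorem le_def {R : PartialOrder A} {p q : IntO R} :
    p ≤ q ↔ R.le q.left p.left ∧ R.le p.right q.right := Iff.rfl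

/-- The order on `IntO R` is inclusion of intervals. -/
theorem le_iff_subset {R : PartialOrder A} {p q : IntO R} :
    p ≤ q ↔ ({x | R.le p.left x ∧ R.le x p.right} : Set A) ⊆
      {x | R.le q.left x ∧ R.le x q.right} := by
  let _ := R
  have hp : R.le p.left p.right := le_of_lt p.lt
  constructor
  · rintro ⟨h1, h2⟩ x ⟨h3, h4⟩
    exact ⟨R.le_trans _ _ _ h1 h3, R.le_trans _ _ _ h4 h2⟩
  · intro h
    exact ⟨(h ⟨R.le_refl _, hp⟩).1, (h ⟨hp, R.le_refl _⟩).2⟩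

instance {R : PartialOrder A} [Finite A] : Finite (IntO R) :=
  Finite.of_injective (fun p : IntO R => (p.left, p.right)) fun _ _ h =>
    IntO.ext (congrArg Prod.fst h) (congrArg Prod.snd h)

/-- An order embedding `f` of posets sends the interval `[i, j]` to `[f i, f j]`. -/
def map {P : PartialOrder A} {R : PartialOrder C} (f : A → C)
    (h : ∀ i j, R.le (f i) (f j) ↔ P.le i j) (p : IntO P) : IntO R :=
  ⟨f p.left, f p.right, by
    have hp := (P.lt_iff_le_not_ge _ _).1 p.lt
    exact (R.lt_iff_le_not_ge _ _).2
      ⟨(h _ _).2 hp.1, fun h' => hp.2 ((h _ _).1 h')⟩⟩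

theorem map_le_map {P : PartialOrder A} {R : PartialOrder C} {f : A → C}
    {h : ∀ i j, R.le (f i) (f j) ↔ P.le i j} {p q : IntO P} :
    map f h p ≤ map f h q ↔ p ≤ q :=
  and_congr (h _ _) (h _ _)

end IntO

/-- The antichains of a poset. -/
def Anti (P : Type*) [PartialOrder P] : Type _ := {s : Set P // IsAntichain (· ≤ ·) s}

noncomputable instance {P : Type*} [PartialOrder P] [Finite P] : Fintype (Anti P) :=
  @Fintype.ofFinite _ (inferInstanceAs (Finite {s : Set P // IsAntichain (· ≤ ·) s}))

/-- The set `pp_nn(R)` of non-nesting `R`-partitions: the antichains of proper intervals. -/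
abbrev PPnn (R : PartialOrder A) : Type _ := Anti (IntO R)

/-- The poset `R_{[i,j]}`: one has `k ≺ l` in it if and only if `k ≺ l` in `R` and `[k, l]` is not
contained in `[i, j]`. -/
@[reducible]
def cutPoset (R : PartialOrder A) (p : IntO R) : PartialOrder A where
  le k l := k = l ∨ ∃ h : R.lt k l, ¬ (⟨k, l, h⟩ : IntO R) ≤ p
  lt k l := ∃ h : R.lt k l, ¬ (⟨k, l, h⟩ : IntO R) ≤ p
  lt_iff_le_not_ge k l := by
    let _ := R
    constructor
    · rintro ⟨h, h'⟩
      refine ⟨Or.inr ⟨h, h'⟩, ?_⟩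
      rintro (rfl | ⟨h2, _⟩)
      · exact lt_irrefl _ h
      · exact lt_asymm h h2
    · rintro ⟨rfl | h, h'⟩
      · exact absurd (Or.inl rfl) h'
      · exact h
  le_refl k := Or.inl rfl
  le_trans k l m := by
    let _ := R
    rintro (rfl | ⟨h1, h1'⟩) (rfl | ⟨h2, h2'⟩)
    · exact Or.inl rfl
    · exact Or.inr ⟨h2, h2'⟩
    · exact Or.inr ⟨h1, h1'⟩
    · refine Or.inr ⟨lt_trans h1 h2, fun h => h1' ⟨h.1, R.le_trans _ _ _ (le_of_lt h2) h.2⟩⟩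
  le_antisymm k l := by
    let _ := R
    rintro (rfl | ⟨h1, _⟩) (h2 | ⟨h2, _⟩)
    · rfl
    · rfl
    · exact h2.symm
    · exact absurd h2 (lt_asymm h1)

theorem cutPoset_lt {R : PartialOrder A} {p : IntO R} {k l : A} :
    (cutPoset R p).lt k l ↔ ∃ h : R.lt k l, ¬ (⟨k, l, h⟩ : IntO R) ≤ p := Iff.rfl

end Intervals

/-! ## Constructions on posets -/

section Posets

variable {A B C : Type*}

/-- The order relation of the concatenation `P.Q` on the disjoint union of `A` and `B`. -/
def concatLE (P : PartialOrder A) (Q : PartialOrder B) : A ⊕ B → A ⊕ B → Prop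
  | .inl i, .inl j => P.le i j
  | .inl _, .inr _ => True
  | .inr _, .inl _ => False
  | .inr i, .inr j => Q.le i j

/-- The concatenation `P.Q`: every element of `A` is below every element of `B`. -/
@[reducible]
def concat (P : PartialOrder A) (Q : PartialOrder B) : PartialOrder (A ⊕ B) where
  le := concatLE P Q
  lt x y := concatLE P Q x y ∧ ¬ concatLE P Q y x
  lt_iff_le_not_ge _ _ := Iff.rfl
  le_refl
    | .inl i => P.le_refl i
    | .inr i => Q.le_refl i
  le_trans
    | .inl i, .inl j, .inl k => P.le_trans i j k
    | .inl _, .inl _, .inr _ => fun _ _ => trivial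
    | .inl _, .inr _, .inl _ => fun _ h => h.elim
    | .inl _, .inr _, .inr _ => fun _ _ => trivial
    | .inr _, .inl _, _ => fun h => h.elim
    | .inr _, .inr _, .inl _ => fun _ h => h.elim
    | .inr i, .inr j, .inr k => Q.le_trans i j k
  le_antisymm
    | .inl i, .inl j => fun h1 h2 => congrArg Sum.inl (P.le_antisymm i j h1 h2)
    | .inl _, .inr _ => fun _ h => h.elim
    | .inr _, .inl _ => fun h => h.elim
    | .inr i, .inr j => fun h1 h2 => congrArg Sum.inr (Q.le_antisymm i j h1 h2)

/-- The order relation of the disjoint union of two posets. -/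
def disjUnionLE (P : PartialOrder A) (Q : PartialOrder B) : A ⊕ B → A ⊕ B → Prop
  | .inl i, .inl j => P.le i j
  | .inl _, .inr _ => False
  | .inr _, .inl _ => False
  | .inr i, .inr j => Q.le i j

/-- The disjoint union of two posets: no element of `A` is comparable to an element of `B`. -/
@[reducible]
def disjUnion (P : PartialOrder A) (Q : PartialOrder B) : PartialOrder (A ⊕ B) where
  le := disjUnionLE P Q
  lt x y := disjUnionLE P Q x y ∧ ¬ disjUnionLE P Q y x
  lt_iff_le_not_ge _ _ := Iff.rfl
  le_refl
    | .inl i => P.le_refl i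
    | .inr i => Q.le_refl i
  le_trans
    | .inl i, .inl j, .inl k => P.le_trans i j k
    | .inl _, .inl _, .inr _ => fun _ h => h.elim
    | .inl _, .inr _, _ => fun h => h.elim
    | .inr _, .inl _, _ => fun h => h.elim
    | .inr _, .inr _, .inl _ => fun _ h => h.elim
    | .inr i, .inr j, .inr k => Q.le_trans i j k
  le_antisymm
    | .inl i, .inl j => fun h1 h2 => congrArg Sum.inl (P.le_antisymm i j h1 h2)
    | .inl _, .inr _ => fun h => h.elim
    | .inr _, .inl _ => fun h => h.elim
    | .inr i, .inr j => fun h1 h2 => congrArg Sum.inr (Q.le_antisymm i j h1 h2)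

/-- The restriction of a poset on `C` to a subset `A`, given by an injection `f : A ↪ C`. -/
@[reducible]
def restr (R : PartialOrder C) (f : A ↪ C) : PartialOrder A where
  le i j := R.le (f i) (f j)
  lt i j := R.le (f i) (f j) ∧ ¬ R.le (f j) (f i)
  lt_iff_le_not_ge _ _ := Iff.rfl
  le_refl i := R.le_refl (f i)
  le_trans i j k := R.le_trans (f i) (f j) (f k)
  le_antisymm _ _ h1 h2 := f.injective (R.le_antisymm _ _ h1 h2)

/-- The proper intervals of the restriction, as proper intervals of the poset. -/
def IntO.incl {R : PartialOrder C} {f : A ↪ C} (p : IntO (restr R f)) : IntO R :=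
  IntO.map f (fun _ _ => Iff.rfl) p

/-- The union `lam ∪ nu`, for non-nesting partitions of `P` and of `Q`, as a non-nesting partition
of the concatenation `P.Q`. -/
def unionConcat {P : PartialOrder A} {Q : PartialOrder B} (lam : PPnn P) (nu : PPnn Q) :
    PPnn (concat P Q) :=
  ⟨IntO.map Sum.inl (fun _ _ => Iff.rfl) '' lam.1 ∪ IntO.map Sum.inr (fun _ _ => Iff.rfl) '' nu.1, by
    rintro _ (⟨p, hp, rfl⟩ | ⟨p, hp, rfl⟩) _ (⟨q, hq, rfl⟩ | ⟨q, hq, rfl⟩) hne hle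
    · exact lam.2 hp hq (fun h => hne (by rw [h])) (IntO.map_le_map.1 hle)
    · exact hle.1
    · exact hle.2
    · exact nu.2 hp hq (fun h => hne (by rw [h])) (IntO.map_le_map.1 hle)⟩

/-- The union `lam ∪ nu`, for non-nesting partitions of `P` and of `Q`, as a non-nesting partition
of the disjoint union of `P` and `Q`. -/
def unionDisj {P : PartialOrder A} {Q : PartialOrder B} (lam : PPnn P) (nu : PPnn Q) :
    PPnn (disjUnion P Q) :=
  ⟨IntO.map Sum.inl (fun _ _ => Iff.rfl) '' lam.1 ∪ IntO.map Sum.inr (fun _ _ => Iff.rfl) '' nu.1, by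
    rintro _ (⟨p, hp, rfl⟩ | ⟨p, hp, rfl⟩) _ (⟨q, hq, rfl⟩ | ⟨q, hq, rfl⟩) hne hle
    · exact lam.2 hp hq (fun h => hne (by rw [h])) (IntO.map_le_map.1 hle)
    · exact hle.1
    · exact hle.1
    · exact nu.2 hp hq (fun h => hne (by rw [h])) (IntO.map_le_map.1 hle)⟩

/-- The non-nesting partition `lam_A` of `R|_A`: the intervals in `lam` with both endpoints
in `A`. -/
def restrPP {R : PartialOrder C} (f : A ↪ C) (lam : PPnn R) : PPnn (restr R f) :=
  ⟨{p | p.incl ∈ lam.1}, fun _ hp _ hq hne hle => lam.2 hp hq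
    (fun h => hne (le_antisymm (IntO.map_le_map.1 h.le) (IntO.map_le_map.1 h.ge)))
    (IntO.map_le_map.2 hle)⟩

/-- The set `Int^lam_mu`, for `lam` a non-nesting partition of `R` and `mu` a non-nesting
partition of `R|_A`: the proper intervals of `R|_A` that belong to the intersection of the posets
`(R|_A)_{[k,l]}`, `[k, l] ∈ mu`, and not to the intersection of the posets `R_{[k,l]}`,
`[k, l] ∈ lam`. It is ordered by inclusion of intervals of `R|_A`. -/
def intBetween {R : PartialOrder C} (f : A ↪ C) (lam : PPnn R) (mu : PPnn (restr R f)) :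
    Set (IntO (restr R f)) :=
  {p | (∀ k ∈ mu.1, (cutPoset (restr R f) k).lt p.left p.right) ∧
    ¬ ∀ k ∈ lam.1, (cutPoset R k).lt (f p.left) (f p.right)}

/-- The union `lam_A ∪ nu`, for an antichain `nu` of `Int^lam_{lam_A}`, as a non-nesting partition
of `R|_A`. -/
def unionAnti {R : PartialOrder C} (f : A ↪ C) (lam : PPnn R)
    (nu : Anti (intBetween f lam (restrPP f lam))) : PPnn (restr R f) :=
  ⟨(restrPP f lam).1 ∪ Subtype.val '' nu.1, by
    rintro p (hp | ⟨p, hp, rfl⟩) q (hq | ⟨q, hq, rfl⟩) hne hle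
    · exact (restrPP f lam).2 hp hq hne hle
    · obtain ⟨h1, h2⟩ := q.2
      apply h2
      intro k hk
      refine cutPoset_lt.2 ⟨(q.1.incl).lt, fun hqk => ?_⟩
      have hpq : p.incl ≤ q.1.incl := IntO.map_le_map.2 hle
      have hpk : p.incl = k := by
        by_contra hcon
        exact lam.2 hp hk hcon (hpq.trans hqk)
      have hqp : q.1 ≤ p := IntO.map_le_map.1 (show q.1.incl ≤ p.incl from hpk ▸ hqk)
      exact hne (le_antisymm hle hqp)
    · obtain ⟨h, h'⟩ := cutPoset_lt.1 (p.2.1 q hq)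
      exact h' hle
    · exact nu.2 hp hq (fun h => hne (by rw [h])) hle⟩

end Posets

/-! ## The supercharacters of pattern groups -/

section Supercharacters

variable {A : Type*} [Fintype A] [DecidableEq A] (F : Type*) [Field F] [Finite F]
  {R : PartialOrder A}

/-- The normal pattern subgroup `UT_lam`: the intersection over `[i, j] ∈ lam` of the subgroups
`UT_{R_{[i,j]}}`. -/
noncomputable def UTlam (lam : PPnn R) : Subgroup (UT F R) :=
  ⨅ p ∈ lam.1, patternSubgroup F R (cutPoset R p)

/-- The supercharacter `χ^lam` of `UT_R`. -/
noncomputable def chi (lam : PPnn R) : UT F R → ℂ :=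
  superchar (NPtt F R) (UTlam F lam)

end Supercharacters

/-! ## Inflation and restriction -/

section Maps

/-- The identification of `f(X) ⊗ f(Y)` with `f(X × Y)`, for finite sets `X` and `Y`. -/
noncomputable def tensorEquiv (X Y : Type*) [Finite Y] :
    (X → ℂ) ⊗[ℂ] (Y → ℂ) ≃ₗ[ℂ] (X × Y → ℂ) :=
  letI := Fintype.ofFinite Y
  letI := Classical.decEq Y
  (TensorProduct.piScalarRight ℂ ℂ (X → ℂ) Y).trans
    { toFun := fun h z => h z.2 z.1
      invFun := fun h y x => h (x, y)
      map_add' := fun _ _ => rfl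
      map_smul' := fun _ _ => rfl
      left_inv := fun _ => rfl
      right_inv := fun _ => rfl }

theorem tensorEquiv_tmul {X Y : Type*} [Finite Y] (f : X → ℂ) (g : Y → ℂ) (z : X × Y) :
    tensorEquiv X Y (f ⊗ₜ g) z = f z.1 * g z.2 := by
  simp [tensorEquiv, mul_comm]

variable {A B : Type*} [Fintype A] [DecidableEq A] [Fintype B] [DecidableEq B]
  {F : Type*} [Field F]

/-- The projection of `UT_{P.Q}` onto `UT_P × UT_Q` to the two diagonal blocks. -/
def projAB {P : PartialOrder A} {Q : PartialOrder B} (u : UT F (concat P Q)) :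
    UT F P × UT F Q :=
  (⟨fun i j => u.1 (.inl i) (.inl j), fun i => u.2.1 (.inl i),
      fun i j h => u.2.2 (.inl i) (.inl j) h⟩,
    ⟨fun i j => u.1 (.inr i) (.inr j), fun i => u.2.1 (.inr i),
      fun i j h => u.2.2 (.inr i) (.inr j) h⟩)

/-- The block diagonal embedding of `UT_{R|_A} × UT_{R|_B}` into `UT_R`, for a poset `R` on the
disjoint union of `A` and `B`. -/
def inclAB {R : PartialOrder (A ⊕ B)}
    (z : UT F (restr R (Function.Embedding.inl : A ↪ A ⊕ B)) ×
      UT F (restr R (Function.Embedding.inr : B ↪ A ⊕ B))) : UT F R :=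
  ⟨Matrix.fromBlocks z.1.1 0 0 z.2.1, by
    refine ⟨?_, ?_⟩
    · rintro (i | i)
      · exact z.1.2.1 i
      · exact z.2.2.1 i
    · rintro (i | i) (j | j) h
      · exact z.1.2.2 i j h
      · rfl
      · rfl
      · exact z.2.2.2 i j h⟩

variable [Finite F]

/-- The product `Inf_{A,B}` of the Hopf monoid: inflation along the projection of `UT_{P.Q}` onto
`UT_P × UT_Q`. -/
noncomputable def Inf (P : PartialOrder A) (Q : PartialOrder B) :
    (UT F P → ℂ) ⊗[ℂ] (UT F Q → ℂ) →ₗ[ℂ] (UT F (concat P Q) → ℂ) :=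
  LinearMap.funLeft ℂ ℂ projAB ∘ₗ (tensorEquiv (UT F P) (UT F Q)).toLinearMap

/-- The coproduct `Res_{A,B}` of the Hopf monoid: restriction along the embedding of
`UT_{R|_A} × UT_{R|_B}` into `UT_R`. -/
noncomputable def Res (R : PartialOrder (A ⊕ B)) :
    (UT F R → ℂ) →ₗ[ℂ] (UT F (restr R (Function.Embedding.inl : A ↪ A ⊕ B)) → ℂ) ⊗[ℂ]
      (UT F (restr R (Function.Embedding.inr : B ↪ A ⊕ B)) → ℂ) :=
  (tensorEquiv _ _).symm.toLinearMap ∘ₗ LinearMap.funLeft ℂ ℂ inclAB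

end Maps

end PatternGroup

/-! Write q = |F|. Normal pattern subgroups of `UT F R` correspond, with inclusion reversed, to
down-sets D of proper intervals: `normalPattern F D` consists of the matrices vanishing on D. Since
`normalPattern F (D ⊓ D')` lies in the join of the two subgroups (`normalPattern_inf_le`), every
irreducible ψ has a least down-set `charLower ψ` whose subgroup lies in its kernel. The block
defining χ^λ is then the set of ψ with `charLower ψ` equal to the down-set generated by λ
(`charBlock_normalPattern`).

More generally, sum ψ(1)ψ over all ψ with T ⊆ `charLower ψ` ⊆ D, where T consists of maximal
elements of D. For T = ∅ this is the inflated regular character of a quotient, with value ∏ q[u_p =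
0] over p ∈ D. Inclusion-exclusion over T subtracts 1 from the factor at each p ∈ T
(`blockSum_eq_prod`). Hence χ^λ is an explicit product of local factors indexed by intervals.

For (a), intervals from A to B are not below any member of λ ∪ ν, so they contribute 1. For (b), the
product at a block diagonal matrix splits into an A-part, a B-part and a constant from the mixed
intervals. The A-part is the sum above for T = λ_A and D the restricted down-set. The down-sets L
with T ⊆ L ⊆ D are generated by the antichains λ_A ∪ ν, so this sum equals the sum of the χ^{λ_A ∪
ν}; the same holds for B. The scalar is found by comparing values at 1, using
`card_normalPattern_mul_prod`. -/

namespace PatternGroup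

/-! ### Irreducible characters and normal subgroups of a finite group -/

section Representations

variable {G : Type*} [Group G]

/-- Every finite-dimensional representation has the character of a representation on some
`Fin n → ℂ`. -/
theorem exists_character_eq {V : Type*} [AddCommGroup V] [Module ℂ V] [FiniteDimensional ℂ V]
    (ρ : Representation ℂ G V) :
    ∃ σ : Representation ℂ G (Fin (Module.finrank ℂ V) → ℂ), σ.character = ρ.character := by
  let e : V ≃ₗ[ℂ] (Fin (Module.finrank ℂ V) → ℂ) := (Module.finBasis ℂ V).equivFun
  refine ⟨{ toFun := fun g => e.conj (ρ g), map_one' := ?_, map_mul' := ?_ }, ?_⟩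
  · rw [map_one]
    exact e.conj_id
  · intro g h
    rw [map_mul]
    exact e.conj_comp _ _
  · funext g
    exact LinearMap.trace_conj' (ρ g) e

theorem character_eq_add_of_isCompl [Finite G] {V : Type*} [AddCommGroup V] [Module ℂ V]
    [FiniteDimensional ℂ V] {ρ : Representation ℂ G V} {W W' : Subrepresentation ρ}
    (h : IsCompl W.toSubmodule W'.toSubmodule) :
    ρ.character = W.toRepresentation.character + W'.toRepresentation.character := by
  funext g
  let e := Submodule.prodEquivOfIsCompl _ _ h
  have h1 : ρ g = e.conj ((W.toRepresentation g).prodMap (W'.toRepresentation g)) := by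
    refine LinearMap.ext fun v => ?_
    obtain ⟨w, rfl⟩ := e.surjective v
    rw [LinearEquiv.conj_apply_apply, e.symm_apply_apply]
    simp only [e, Submodule.coe_prodEquivOfIsCompl', LinearMap.prodMap_apply, map_add]
    rfl
  change LinearMap.trace ℂ V (ρ g) = _
  rw [h1, LinearMap.trace_conj', LinearMap.trace_prodMap']
  rfl

/-- By Maschke's theorem, characters are linear combinations of irreducible characters. -/
theorem character_mem_span_irr [Finite G] {V : Type*} [AddCommGroup V] [Module ℂ V]
    [FiniteDimensional ℂ V] (ρ : Representation ℂ G V) :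
    ρ.character ∈ Submodule.span ℂ (irr G) := by
  obtain ⟨σ, hσ⟩ := exists_character_eq ρ
  rw [← hσ]
  clear hσ ρ
  generalize Module.finrank ℂ V = n at σ
  induction n using Nat.strong_induction_on with
  | _ n ih =>
    by_cases hirr : σ.IsIrreducible
    · exact Submodule.subset_span ⟨n, σ, hirr, rfl⟩
    by_cases hnt : Nontrivial (Subrepresentation σ)
    · obtain ⟨W, hW0, hW1⟩ : ∃ W : Subrepresentation σ, W ≠ ⊥ ∧ W ≠ ⊤ := by
        by_contra hcon
        push Not at hcon
        exact hirr { eq_bot_or_eq_top := fun W => or_iff_not_imp_left.2 (hcon W) }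
      obtain ⟨W', hW'⟩ := exists_isCompl W
      have hcompl : IsCompl W.toSubmodule W'.toSubmodule := by
        refine IsCompl.of_eq ?_ ?_
        · rw [← Subrepresentation.toSubmodule_inf, hW'.inf_eq_bot]
          rfl
        · rw [← Subrepresentation.toSubmodule_sup, hW'.sup_eq_top]
          rfl
      have hlt : ∀ W : Subrepresentation σ, W ≠ ⊤ → Module.finrank ℂ W.toSubmodule < n := by
        intro W hW
        have h := Submodule.finrank_lt (s := W.toSubmodule)
          (fun h => hW (Subrepresentation.toSubmodule_injective h))
        rwa [Module.finrank_fin_fun] at h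
      have hW1' : W' ≠ ⊤ := fun h => hW0 (by simpa [h] using hW'.inf_eq_bot)
      rw [character_eq_add_of_isCompl hcompl]
      obtain ⟨τ, hτ⟩ := exists_character_eq W.toRepresentation
      obtain ⟨τ', hτ'⟩ := exists_character_eq W'.toRepresentation
      rw [← hτ, ← hτ']
      exact add_mem (ih _ (hlt W hW1) τ) (ih _ (hlt W' hW1') τ')
    · have hn : n = 0 := by
        by_contra hn
        refine hnt ⟨⊥, ⊤, fun h => ?_⟩
        have h2 : (⊥ : Submodule ℂ (Fin n → ℂ)) = ⊤ :=
          congrArg Subrepresentation.toSubmodule h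
        have h3 := congrArg (fun p : Submodule ℂ (Fin n → ℂ) => Module.finrank ℂ p) h2
        simp only [finrank_bot, finrank_top, Module.finrank_fin_fun] at h3
        exact hn h3.symm
      subst hn
      have h0 : σ.character = 0 := by
        funext g
        have : σ g = 0 := Subsingleton.elim _ _
        simp [Representation.character, this]
      rw [h0]
      exact zero_mem _

/-- In the basis of group elements the trace counts the h with gh = h. -/
theorem character_leftRegular [Fintype G] [DecidableEq G] (g : G) :
    (Representation.leftRegular ℂ G).character g = if g = 1 then (Nat.card G : ℂ) else 0 := by
  let b : Module.Basis G ℂ (MonoidAlgebra ℂ G) := MonoidAlgebra.basis G ℂ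
  change LinearMap.trace ℂ _ (Representation.leftRegular ℂ G g) = _
  rw [LinearMap.trace_eq_matrix_trace ℂ b, Matrix.trace]
  have h1 : ∀ h : G, (LinearMap.toMatrix b b (Representation.leftRegular ℂ G g)).diag h =
      if g = 1 then 1 else 0 := by
    intro h
    rw [Matrix.diag_apply, LinearMap.toMatrix_apply]
    have h2 : b h = MonoidAlgebra.single h 1 := by simp [b]
    rw [h2, Representation.leftRegular, Representation.ofMulAction_single]
    have h3 : b (g • h) = MonoidAlgebra.single (g • h) 1 := by simp [b]
    rw [← h3, b.repr_self, Finsupp.single_apply]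
    simp
  rw [Finset.sum_congr rfl fun h _ => h1 h]
  simp

theorem card_inv_mul_sum_irr [Fintype G] {ψ φ : G → ℂ} (hψ : ψ ∈ irr G) (hφ : φ ∈ irr G) :
    (Nat.card G : ℂ)⁻¹ * ∑ g : G, ψ g * φ g⁻¹ = if ψ = φ then 1 else 0 := by
  classical
  have hcard : (Nat.card G : ℂ) ≠ 0 := Nat.cast_ne_zero.2 Nat.card_pos.ne'
  let _ : Invertible (Nat.card G : ℂ) := invertibleOfNonzero hcard
  obtain ⟨n, ρ, hρ, rfl⟩ := hψ
  obtain ⟨m, σ, hσ, rfl⟩ := hφ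
  have h := Representation.char_orthonormal ρ σ
  by_cases hiso : Nonempty (Representation.Equiv σ ρ)
  · rw [h, if_pos hiso, if_pos (Representation.char_iso hiso.some).symm]
  · have he : ρ.character ≠ σ.character := by
      intro he
      have h2 := Representation.char_orthonormal ρ ρ
      rw [if_pos ⟨Representation.Equiv.refl ρ⟩] at h2
      rw [if_neg hiso, ← he, h2] at h
      exact one_ne_zero h
    rw [h, if_neg hiso, if_neg he]

open Classical in
/-- The decomposition of the regular character. -/
theorem sum_irr_one_mul [Finite G] (g : G) :
    ∑ ψ ∈ (finite_irr G).toFinset, ψ 1 * ψ g = if g = 1 then (Nat.card G : ℂ) else 0 := by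
  have := Fintype.ofFinite G
  have hcard : (Nat.card G : ℂ) ≠ 0 := Nat.cast_ne_zero.2 Nat.card_pos.ne'
  have hspan := character_mem_span_irr (Representation.leftRegular ℂ G)
  rw [← (finite_irr G).coe_toFinset, Submodule.mem_span_finset] at hspan
  obtain ⟨c, -, hc⟩ := hspan
  have hc' : ∀ g, ∑ ψ ∈ (finite_irr G).toFinset, c ψ * ψ g =
      if g = 1 then (Nat.card G : ℂ) else 0 := by
    intro g
    rw [← character_leftRegular, ← hc, Finset.sum_apply]
    rfl
  rw [← hc' g]
  refine Finset.sum_congr rfl fun φ hφ => ?_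
  rw [(finite_irr G).mem_toFinset] at hφ
  congr 1
  -- Pairing with φ recovers c φ by orthogonality; on the regular character the same pairing sees
  -- only g = 1 and gives φ 1.
  have h1 : (Nat.card G : ℂ)⁻¹ *
      ∑ g : G, (∑ ψ ∈ (finite_irr G).toFinset, c ψ * ψ g) * φ g⁻¹ = c φ := by
    simp_rw [Finset.sum_mul]
    rw [Finset.sum_comm, Finset.mul_sum, Finset.sum_eq_single φ]
    · simp_rw [mul_assoc]
      rw [← Finset.mul_sum, mul_left_comm, card_inv_mul_sum_irr hφ hφ, if_pos rfl, mul_one]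
    · intro ψ hψ hne
      rw [(finite_irr G).mem_toFinset] at hψ
      simp_rw [mul_assoc]
      rw [← Finset.mul_sum, mul_left_comm, card_inv_mul_sum_irr hψ hφ, if_neg hne, mul_zero]
    · exact fun h => absurd ((finite_irr G).mem_toFinset.2 hφ) h
  rw [← h1]
  simp_rw [hc', ite_mul, zero_mul]
  simp

/-- For a normal subgroup `N`, the sum of an irreducible representation over `N` is either
zero or a multiple of the identity, the latter only if `N` acts trivially. -/
theorem sum_eq_zero_or_forall_eq_one [Finite G] {n : ℕ} (ρ : Representation ℂ G (Fin n → ℂ))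
    [ρ.IsIrreducible] (N : Subgroup G) [N.Normal] [Fintype N] :
    (∑ x : N, ρ x) = 0 ∨ ∀ x ∈ N, ρ x = 1 := by
  have hcomm : ∀ g, (∑ x : N, ρ x) * ρ g = ρ g * ∑ x : N, ρ x := by
    intro g
    rw [Finset.sum_mul, Finset.mul_sum]
    refine Fintype.sum_equiv (MulAut.conjNormal g⁻¹).toEquiv _ _ fun x => ?_
    rw [← map_mul, ← map_mul]
    congr 1
    simp [mul_assoc]
  -- The sum over N commutes with the action, so its kernel is invariant, hence ⊥ or ⊤.
  let K : Subrepresentation ρ :=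
    { toSubmodule := LinearMap.ker (∑ x : N, ρ x)
      apply_mem_toSubmodule := by
        intro g v hv
        rw [LinearMap.mem_ker] at hv ⊢
        have := LinearMap.congr_fun (hcomm g) v
        rw [Module.End.mul_apply, Module.End.mul_apply, hv, map_zero] at this
        exact this }
  rcases eq_bot_or_eq_top K with hK | hK
  · right
    intro y hy
    have hker : LinearMap.ker (∑ x : N, ρ x) = ⊥ := congrArg Subrepresentation.toSubmodule hK
    -- Translation by y permutes N; injectivity of the sum then cancels it and leaves ρ y = 1.
    have hy' : (∑ x : N, ρ x) * ρ y = ∑ x : N, ρ x := by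
      rw [Finset.sum_mul]
      refine Fintype.sum_equiv (Equiv.mulRight (⟨y, hy⟩ : N)) _ _ fun x => ?_
      rw [← map_mul]
      rfl
    refine LinearMap.ext fun v => LinearMap.ker_eq_bot.1 hker ?_
    exact LinearMap.congr_fun hy' v
  · left
    have hker : LinearMap.ker (∑ x : N, ρ x) = ⊤ := congrArg Subrepresentation.toSubmodule hK
    exact LinearMap.ker_eq_top.1 hker

theorem sum_eq_zero_or_subset_charKer [Finite G] {ψ : G → ℂ} (hψ : ψ ∈ irr G)
    (N : Subgroup G) [N.Normal] [Fintype N] :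
    (∀ g, ∑ x : N, ψ (g * x) = 0) ∨ ∀ x ∈ N, ∀ g, ψ (g * x) = ψ g := by
  obtain ⟨n, ρ, hρ, rfl⟩ := hψ
  refine (sum_eq_zero_or_forall_eq_one ρ N).imp (fun h g => ?_) (fun h x hx g => ?_)
  · have h1 : ∑ x : N, ρ (g * x) = 0 := by
      simp_rw [map_mul]
      rw [← Finset.mul_sum, h, mul_zero]
    have h2 := congrArg (LinearMap.trace ℂ (Fin n → ℂ)) h1
    rw [map_sum, map_zero] at h2
    exact h2
  · simp only [Representation.character]
    rw [map_mul, h x hx, mul_one]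

theorem irr_apply_one_ne_zero {ψ : G → ℂ} (hψ : ψ ∈ irr G) : ψ 1 ≠ 0 := by
  obtain ⟨n, ρ, hρ, rfl⟩ := hψ
  rw [Representation.char_one, Module.finrank_fin_fun]
  rintro h
  have hn : n = 0 := by exact_mod_cast h
  subst hn
  obtain ⟨W, W', hne⟩ := hρ.toNontrivial
  refine hne (Subrepresentation.toSubmodule_injective ?_)
  exact Subsingleton.elim _ _

/-- A normal subgroup in the kernel of an irreducible character does not change its values. -/
theorem subset_charKer_iff [Finite G] {ψ : G → ℂ} (hψ : ψ ∈ irr G) (N : Subgroup G) [N.Normal] :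
    (N : Set G) ⊆ charKer ψ ↔ ∀ x ∈ N, ∀ g, ψ (g * x) = ψ g := by
  have := Fintype.ofFinite N
  constructor
  · intro h
    refine (sum_eq_zero_or_subset_charKer hψ N).resolve_left fun h0 => ?_
    have h1 := h0 1
    have h2 : ∀ x : N, ψ (1 * x) = ψ 1 := fun x => by
      rw [one_mul]
      exact h x.2
    rw [Finset.sum_congr rfl fun x _ => h2 x, Finset.sum_const, nsmul_eq_mul] at h1
    rcases mul_eq_zero.1 h1 with h3 | h3
    · rw [Nat.cast_eq_zero, Finset.card_univ] at h3
      exact Fintype.card_ne_zero h3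
    · exact irr_apply_one_ne_zero hψ h3
  · intro h x hx
    have := h x hx 1
    rwa [one_mul] at this

/-- `charKer` is only a set, so closure under products comes from translation invariance of ψ under
each subgroup. This is what yields a largest normal pattern subgroup in a kernel. -/
theorem sup_subset_charKer [Finite G] {ψ : G → ℂ} (hψ : ψ ∈ irr G) {N M : Subgroup G} [N.Normal]
    [M.Normal] (hN : (N : Set G) ⊆ charKer ψ) (hM : (M : Set G) ⊆ charKer ψ) :
    ((N ⊔ M : Subgroup G) : Set G) ⊆ charKer ψ := by
  rw [subset_charKer_iff hψ] at hN hM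
  intro x hx
  obtain ⟨y, hy, z, hz, rfl⟩ := Subgroup.mem_sup_of_normal_left.1 hx
  change ψ (y * z) = ψ 1
  rw [hM z hz, ← hN y hy 1, one_mul]

open Classical in
/-- The regular character of the quotient by a normal subgroup, inflated. -/
theorem sum_irr_filter_one_mul [Finite G] (N : Subgroup G) [N.Normal] (g : G) :
    ∑ ψ ∈ (finite_irr G).toFinset with (N : Set G) ⊆ charKer ψ, ψ 1 * ψ g =
      if g ∈ N then (Nat.card G : ℂ) / Nat.card N else 0 := by
  have := Fintype.ofFinite N
  have hcard : (Nat.card N : ℂ) ≠ 0 := Nat.cast_ne_zero.2 Nat.card_pos.ne'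
  -- Averaging over N kills exactly the characters whose kernel does not contain N.
  have h1 : ∀ ψ ∈ (finite_irr G).toFinset, ∑ x : N, ψ 1 * ψ (g * x) =
      if (N : Set G) ⊆ charKer ψ then Nat.card N * (ψ 1 * ψ g) else 0 := by
    intro ψ hψ
    rw [(finite_irr G).mem_toFinset] at hψ
    rw [← Finset.mul_sum]
    split_ifs with h
    · rw [subset_charKer_iff hψ] at h
      rw [Finset.sum_congr rfl fun (x : N) _ => h x x.2 g]
      simp
      ring
    · rw [subset_charKer_iff hψ] at h
      rw [(sum_eq_zero_or_subset_charKer hψ N).resolve_right h g, mul_zero]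
  have h2 : ∑ x : N, ∑ ψ ∈ (finite_irr G).toFinset, ψ 1 * ψ (g * x) =
      if g ∈ N then (Nat.card G : ℂ) else 0 := by
    simp_rw [sum_irr_one_mul]
    split_ifs with h
    · rw [Finset.sum_eq_single (⟨g⁻¹, N.inv_mem h⟩ : N)]
      · simp
      · intro x _ hx
        refine if_neg fun h' => hx (Subtype.ext ?_)
        exact eq_inv_of_mul_eq_one_right h'
      · exact fun h => absurd (Finset.mem_univ _) h
    · refine Finset.sum_eq_zero fun x _ => if_neg fun h' => h ?_
      rw [eq_inv_of_mul_eq_one_left h']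
      exact N.inv_mem x.2
  rw [Finset.sum_comm, Finset.sum_congr rfl h1, ← Finset.sum_filter, ← Finset.mul_sum] at h2
  rw [eq_comm, ← mul_right_inj' hcard, h2]
  split_ifs
  · rw [mul_div_cancel₀ _ hcard]
  · rw [mul_zero]

end Representations

end PatternGroup

namespace PatternGroup

/-! ### Normal pattern subgroups as down-sets of intervals -/

section NormalPattern

variable {A : Type*} {R : PartialOrder A}

noncomputable instance [Finite A] : Fintype (IntO R) := Fintype.ofFinite _

/-- The subposet of `R` whose proper intervals are the ones outside a down-set `D`. -/
@[reducible]
def lowerPoset (D : LowerSet (IntO R)) : PartialOrder A where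
  le k l := k = l ∨ ∃ h : R.lt k l, (⟨k, l, h⟩ : IntO R) ∉ D
  lt k l := ∃ h : R.lt k l, (⟨k, l, h⟩ : IntO R) ∉ D
  lt_iff_le_not_ge k l := by
    let _ := R
    constructor
    · rintro ⟨h, h'⟩
      refine ⟨Or.inr ⟨h, h'⟩, ?_⟩
      rintro (rfl | ⟨h2, _⟩)
      · exact lt_irrefl _ h
      · exact lt_asymm h h2
    · rintro ⟨rfl | h, h'⟩
      · exact absurd (Or.inl rfl) h'
      · exact h
  le_refl k := Or.inl rfl
  le_trans k l m := by
    let _ := R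
    rintro (rfl | ⟨h1, h1'⟩) (rfl | ⟨h2, h2'⟩)
    · exact Or.inl rfl
    · exact Or.inr ⟨h2, h2'⟩
    · exact Or.inr ⟨h1, h1'⟩
    · exact Or.inr ⟨lt_trans h1 h2,
        fun h => h1' (D.lower (show (⟨k, l, h1⟩ : IntO R) ≤ ⟨k, m, lt_trans h1 h2⟩ from
          ⟨R.le_refl _, le_of_lt h2⟩) h)⟩
  le_antisymm k l := by
    let _ := R
    rintro (rfl | ⟨h1, _⟩) (h2 | ⟨h2, _⟩)
    · rfl
    · rfl
    · exact h2.symm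
    · exact absurd h2 (lt_asymm h1)

theorem le_of_lowerPoset_le {D : LowerSet (IntO R)} {i j : A} (h : (lowerPoset D).le i j) :
    R.le i j := by
  let _ := R
  rcases h with rfl | ⟨h, -⟩
  · exact R.le_refl _
  · exact le_of_lt h

variable [Fintype A] [DecidableEq A] {F : Type*} [Field F]

/-- The matrices whose nonzero entries are at proper intervals of `R` outside the down-set `D`. -/
def SupportedOff (D : LowerSet (IntO R)) (x : Matrix A A F) : Prop :=
  ∀ i j, x i j ≠ 0 → ∃ h : R.lt i j, (⟨i, j, h⟩ : IntO R) ∉ D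

/-- Multiplication by a unitriangular matrix moves entries only to larger intervals, and the
complement of a down-set is closed upwards. -/
theorem SupportedOff.mul_left {D : LowerSet (IntO R)} {x : Matrix A A F} (hx : SupportedOff D x)
    (g : UT F R) : SupportedOff D (g.1 * x) := by
  let _ := R
  intro i j hij
  rw [Matrix.mul_apply] at hij
  obtain ⟨k, -, hk⟩ := Finset.exists_ne_zero_of_sum_ne_zero hij
  obtain ⟨h, hD⟩ := hx k j (right_ne_zero_of_mul hk)
  have hik : i ≤ k := by
    by_contra hik
    exact left_ne_zero_of_mul hk (g.2.2 i k hik)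
  exact ⟨lt_of_le_of_lt hik h, fun h' => hD (D.lower (IntO.le_def.2 ⟨hik, le_refl j⟩) h')⟩

theorem SupportedOff.mul_right {D : LowerSet (IntO R)} {x : Matrix A A F} (hx : SupportedOff D x)
    (g : UT F R) : SupportedOff D (x * g.1) := by
  let _ := R
  intro i j hij
  rw [Matrix.mul_apply] at hij
  obtain ⟨k, -, hk⟩ := Finset.exists_ne_zero_of_sum_ne_zero hij
  obtain ⟨h, hD⟩ := hx i k (left_ne_zero_of_mul hk)
  have hkj : k ≤ j := by
    by_contra hkj
    exact right_ne_zero_of_mul hk (g.2.2 k j hkj)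
  exact ⟨lt_of_lt_of_le h hkj, fun h' => hD (D.lower (IntO.le_def.2 ⟨le_refl i, hkj⟩) h')⟩

variable (F) in
/-- The elementary matrix with entry `1` at the proper interval `p`. -/
def rootElement (p : IntO R) : UT F R :=
  ⟨Matrix.transvection p.left p.right 1, by
    let _ := R
    refine ⟨fun i => ?_, fun i j hij => ?_⟩
    · rw [Matrix.transvection, Matrix.add_apply, Matrix.one_apply_eq, Matrix.single_apply_of_ne,
        add_zero]
      rintro ⟨h1, h2⟩
      exact p.lt.ne (h1.trans h2.symm)
    · have hne : i ≠ j := fun h => hij (h ▸ R.le_refl i)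
      rw [Matrix.transvection, Matrix.add_apply, Matrix.one_apply_ne hne,
        Matrix.single_apply_of_ne, add_zero]
      rintro ⟨rfl, rfl⟩
      exact hij (le_of_lt p.lt)⟩

theorem rootElement_apply_of_ne (p : IntO R) {i j : A} (hij : i ≠ j)
    (h : ¬ (p.left = i ∧ p.right = j)) : (rootElement F p).1 i j = 0 := by
  change (Matrix.transvection p.left p.right (1 : F)) i j = 0
  rw [Matrix.transvection, Matrix.add_apply, Matrix.one_apply_ne hij, zero_add,
    Matrix.single_apply_of_ne _ _ _ _ _ h]

theorem rootElement_apply_same (p : IntO R) : (rootElement F p).1 p.left p.right = 1 := by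
  let _ := R
  change (Matrix.transvection p.left p.right (1 : F)) p.left p.right = 1
  rw [Matrix.transvection, Matrix.add_apply, Matrix.one_apply_ne p.lt.ne, zero_add,
    Matrix.single_apply_same]

variable (F) [Finite F]

/-- The matrices of `UT_R` whose entries at the intervals in the down-set `D` vanish. -/
noncomputable def normalPattern (D : LowerSet (IntO R)) : Subgroup (UT F R) :=
  patternSubgroup F R (lowerPoset D)

variable {F}

theorem mem_normalPattern {D : LowerSet (IntO R)} {u : UT F R} :
    u ∈ normalPattern F D ↔ ∀ p ∈ D, u.1 p.left p.right = 0 := by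
  let _ := R
  constructor
  · intro h p hp
    refine h.2 _ _ ?_
    rintro (h1 | ⟨_, h1⟩)
    · exact p.lt.ne h1
    · exact h1 hp
  · intro h
    refine ⟨u.2.1, fun i j hij => ?_⟩
    by_contra hne
    have hle : i ≤ j := by
      by_contra hle
      exact hne (u.2.2 i j hle)
    rcases hle.eq_or_lt with rfl | hlt
    · exact hij (Or.inl rfl)
    · exact hij (Or.inr ⟨hlt, fun hD => hne (h _ hD)⟩)

theorem normalPattern_anti {D D' : LowerSet (IntO R)} (h : D ≤ D') :
    normalPattern F D' ≤ normalPattern F D :=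
  fun _ hu => mem_normalPattern.2 fun p hp => mem_normalPattern.1 hu p (h hp)

/-- Presents the subgroup as 1 + I with I stable under multiplication by `UT F R` on both sides;
normality and the factorization of intersections follow formally. -/
theorem mem_normalPattern_iff_supportedOff {D : LowerSet (IntO R)} {u : UT F R} :
    u ∈ normalPattern F D ↔ SupportedOff D (u.1 - 1) := by
  let _ := R
  rw [mem_normalPattern]
  constructor
  · intro h i j hij
    rw [Matrix.sub_apply] at hij
    have hne : i ≠ j := by
      rintro rfl
      rw [u.2.1, Matrix.one_apply_eq, sub_self] at hij
      exact hij rfl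
    rw [Matrix.one_apply_ne hne, sub_zero] at hij
    have hle : i ≤ j := by
      by_contra hle
      exact hij (u.2.2 i j hle)
    exact ⟨hle.lt_of_ne hne, fun hD => hij (h _ hD)⟩
  · intro h p hp
    by_contra hne
    obtain ⟨_, h2⟩ := h p.left p.right (by
      rwa [Matrix.sub_apply, Matrix.one_apply_ne p.lt.ne, sub_zero])
    exact h2 hp

theorem coe_mul_inv_coe (g : UT F R) : g.1 * (g⁻¹).1 = 1 :=
  congrArg Subtype.val (mul_inv_cancel g)

theorem coe_inv_mul_coe (g : UT F R) : (g⁻¹).1 * g.1 = 1 :=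
  congrArg Subtype.val (inv_mul_cancel g)

instance (D : LowerSet (IntO R)) : (normalPattern F D).Normal where
  conj_mem n hn g := by
    rw [mem_normalPattern_iff_supportedOff] at hn ⊢
    have h : (g * n * g⁻¹).1 - 1 = g.1 * (n.1 - 1) * (g⁻¹).1 := by
      rw [mul_sub, sub_mul, mul_one, coe_mul_inv_coe]
      rfl
    rw [h]
    exact (hn.mul_left g).mul_right g⁻¹

open Classical in
-- Let a be u with its entries in D erased. Then u - a lives on D minus D', so `a⁻¹ * u - 1 = a⁻¹ *
-- (u - a)` is supported off D', and u = a(a⁻¹u).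
theorem normalPattern_inf_le (D D' : LowerSet (IntO R)) :
    normalPattern F (D ⊓ D') ≤ normalPattern F D ⊔ normalPattern F D' := by
  let _ := R
  intro u hu
  have hu' := mem_normalPattern_iff_supportedOff.1 hu
  let a : UT F R := ⟨fun i j => if (lowerPoset D).le i j then u.1 i j else 0, fun i => by
      exact (if_pos ((lowerPoset D).le_refl i)).trans (u.2.1 i), fun i j hij => if_neg fun h =>
        hij (le_of_lowerPoset_le h)⟩
  have ha : a ∈ normalPattern F D := ⟨a.2.1, fun i j hij => if_neg hij⟩
  have hdiff : SupportedOff D' (u.1 - a.1) := by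
    intro i j hij
    have hle : ¬ (lowerPoset D).le i j := by
      intro hle
      refine hij ?_
      rw [Matrix.sub_apply]
      change u.1 i j - (if _ then u.1 i j else 0) = 0
      rw [if_pos hle, sub_self]
    have haij : a.1 i j = 0 := if_neg hle
    rw [Matrix.sub_apply, haij, sub_zero] at hij
    have hne : i ≠ j := fun h => hle (Or.inl h)
    obtain ⟨h, hD⟩ := hu' i j (by rwa [Matrix.sub_apply, Matrix.one_apply_ne hne, sub_zero])
    refine ⟨h, fun h' => hD ⟨?_, h'⟩⟩
    by_contra hcon
    exact hle (Or.inr ⟨h, hcon⟩)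
  have hb : a⁻¹ * u ∈ normalPattern F D' := by
    rw [mem_normalPattern_iff_supportedOff]
    have h : (a⁻¹ * u).1 - 1 = (a⁻¹).1 * (u.1 - a.1) := by
      rw [mul_sub, coe_inv_mul_coe]
      rfl
    rw [h]
    exact hdiff.mul_left _
  have := mul_mem (Subgroup.mem_sup_left (T := normalPattern F D') ha)
    (Subgroup.mem_sup_right (S := normalPattern F D) hb)
  rwa [mul_inv_cancel_left] at this

theorem rootElement_mem_normalPattern {p : IntO R} {D : LowerSet (IntO R)} :
    rootElement F p ∈ normalPattern F D ↔ p ∉ D := by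
  let _ := R
  rw [mem_normalPattern]
  constructor
  · intro h hp
    have := h p hp
    rw [rootElement_apply_same] at this
    exact one_ne_zero this
  · intro h q hq
    refine rootElement_apply_of_ne p q.lt.ne ?_
    rintro ⟨h1, h2⟩
    exact h (IntO.ext h1 h2 ▸ hq)

/-- An interval in D but not in D' gives a root element separating the subgroups. -/
theorem normalPattern_le_iff {D D' : LowerSet (IntO R)} :
    normalPattern F D' ≤ normalPattern F D ↔ D ≤ D' := by
  refine ⟨fun h p hp => ?_, normalPattern_anti⟩
  by_contra hcon
  exact rootElement_mem_normalPattern.1 (h (rootElement_mem_normalPattern.2 hcon)) hp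

theorem normalPattern_lt_iff {D D' : LowerSet (IntO R)} :
    normalPattern F D' < normalPattern F D ↔ D < D' := by
  rw [lt_iff_le_not_ge, lt_iff_le_not_ge, normalPattern_le_iff, normalPattern_le_iff]

/-- The intervals of a poset `Q` with a normal pattern subgroup form an up-set. -/
theorem le_of_normal {Q : PartialOrder A} (hN : (patternSubgroup F R Q).Normal)
    {p p' : IntO R} (hpp' : p ≤ p') (hp : Q.le p.left p.right) : Q.le p'.left p'.right := by
  let _ := R
  have hmem : ∀ p : IntO R, Q.le p.left p.right → rootElement F p ∈ patternSubgroup F R Q := by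
    refine fun p hp => ⟨(rootElement F p).2.1, fun i j hij => rootElement_apply_of_ne p ?_ ?_⟩
    · exact fun h => hij (h ▸ Q.le_refl i)
    · rintro ⟨rfl, rfl⟩
      exact hij hp
  have hval : ∀ p : IntO R, (rootElement F p).1 = 1 + Matrix.single p.left p.right 1 :=
    fun _ => rfl
  -- Conjugating the root element at [i, j] by the one at [k, i] creates a nonzero entry at (k, j).
  have left : ∀ i j k (hki : R.lt k i) (hij : R.lt i j), Q.le i j → Q.le k j := by
    intro i j k hki hij hQ
    have hr := hmem ⟨i, j, hij⟩ hQ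
    have hc := hN.conj_mem _ hr (rootElement F ⟨k, i, hki⟩)
    by_contra hkj
    set n' := rootElement F (⟨k, i, hki⟩ : IntO R) * rootElement F ⟨i, j, hij⟩ *
      (rootElement F ⟨k, i, hki⟩)⁻¹ with hn'
    have h0 : n'.1 k j = 0 := hc.2 k j hkj
    -- With the inverse moved to the other side, comparing entries at (k, j) gives 0 = 1 and needs
    -- no entry of the inverse.
    have heq : n'.1 * (rootElement F (⟨k, i, hki⟩ : IntO R)).1 =
        (rootElement F (⟨k, i, hki⟩ : IntO R)).1 * (rootElement F (⟨i, j, hij⟩ : IntO R)).1 :=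
      congrArg Subtype.val (inv_mul_cancel_right _ _ :
        n' * rootElement F (⟨k, i, hki⟩ : IntO R) = _)
    have h1 := congrFun (congrFun heq k) j
    rw [hval, hval, mul_add, mul_one, Matrix.add_apply, h0, Matrix.mul_single_apply_of_ne,
      add_mul, one_mul, Matrix.add_apply, mul_add, mul_one, Matrix.add_apply,
      Matrix.single_mul_single_same] at h1
    · simp [hki.ne', hij.ne, (hki.trans hij).ne] at h1
    · exact hij.ne'
  have right : ∀ i j k (hij : R.lt i j) (hjk : R.lt j k), Q.le i j → Q.le i k := by
    intro i j k hij hjk hQ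
    have hr := hmem ⟨i, j, hij⟩ hQ
    have hc := hN.conj_mem _ hr (rootElement F ⟨j, k, hjk⟩)⁻¹
    by_contra hik
    set n' := (rootElement F (⟨j, k, hjk⟩ : IntO R))⁻¹ * rootElement F ⟨i, j, hij⟩ *
      ((rootElement F ⟨j, k, hjk⟩)⁻¹)⁻¹ with hn'
    have h0 : n'.1 i k = 0 := hc.2 i k hik
    have heq : (rootElement F (⟨j, k, hjk⟩ : IntO R)).1 * n'.1 =
        (rootElement F (⟨i, j, hij⟩ : IntO R)).1 * (rootElement F (⟨j, k, hjk⟩ : IntO R)).1 :=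
      congrArg Subtype.val (by rw [hn', inv_inv, mul_assoc, mul_inv_cancel_left] :
        rootElement F (⟨j, k, hjk⟩ : IntO R) * n' = _)
    have h1 := congrFun (congrFun heq i) k
    rw [hval, hval, add_mul, one_mul, Matrix.add_apply, h0, Matrix.single_mul_apply_of_ne,
      add_mul, one_mul, Matrix.add_apply, mul_add, mul_one, Matrix.add_apply,
      Matrix.single_mul_single_same] at h1
    · simp [hjk.ne, hij.ne', (hij.trans hjk).ne] at h1
    · exact hij.ne
  have h1 : Q.le p'.left p.right := by
    rcases hpp'.1.eq_or_lt with h | h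
    · rw [h]
      exact hp
    · exact left _ _ _ h p.lt hp
  rcases hpp'.2.eq_or_lt with h | h
  · rw [← h]
    exact h1
  · exact right _ _ _ (lt_of_le_of_lt hpp'.1 p.lt) h h1

/-- By `le_of_normal` the intervals missing from a normal subposet form a down-set. -/
theorem mem_NPtt {N : Subgroup (UT F R)} :
    N ∈ NPtt F R ↔ ∃ D : LowerSet (IntO R), N = normalPattern F D := by
  constructor
  · rintro ⟨hN, Q, hQ, rfl⟩
    refine ⟨⟨{p | ¬ Q.le p.left p.right}, fun p' p h hp hcon => hp (le_of_normal hN h hcon)⟩, ?_⟩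
    ext u
    rw [mem_normalPattern]
    refine ⟨fun h p hp => h.2 _ _ hp, fun h => ⟨u.2.1, fun i j hij => ?_⟩⟩
    by_cases hle : R.le i j
    · have hne : i ≠ j := by
        rintro rfl
        exact hij (Q.le_refl i)
      exact h ⟨i, j, @lt_of_le_of_ne A R _ _ hle hne⟩ hij
    · exact u.2.2 i j hle
  · rintro ⟨D, rfl⟩
    exact ⟨inferInstance, lowerPoset D, fun _ _ => le_of_lowerPoset_le, rfl⟩

theorem UTlam_eq_normalPattern (lam : PPnn R) :
    UTlam F lam = normalPattern F (lowerClosure lam.1) := by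
  let _ := R
  ext u
  simp only [UTlam, Subgroup.mem_iInf, mem_normalPattern]
  constructor
  · rintro h p ⟨q, hq, hpq⟩
    refine (h q hq).2 _ _ ?_
    rintro (h1 | ⟨_, h1⟩)
    · exact p.lt.ne h1
    · exact h1 hpq
  · intro h q hq
    refine ⟨u.2.1, fun i j hij => ?_⟩
    by_cases hle : R.le i j
    · have hne : i ≠ j := fun h => hij (Or.inl h)
      refine h ⟨i, j, lt_of_le_of_ne hle hne⟩ ⟨q, hq, ?_⟩
      by_contra hcon
      exact hij (Or.inr ⟨lt_of_le_of_ne hle hne, hcon⟩)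
    · exact u.2.2 i j hle

open Classical in
-- The entries off D are free coordinates. Writing the order as a product over all intervals lets it
-- be combined factor by factor with character values.
theorem card_normalPattern (D : LowerSet (IntO R)) :
    Nat.card (normalPattern F D) = ∏ p : IntO R, if p ∈ D then 1 else Nat.card F := by
  let _ := R
  let f : normalPattern F D → ({p : IntO R // p ∉ D} → F) :=
    fun u p => u.1.1 p.1.left p.1.right
  have hf : Function.Bijective f := by
    constructor
    · intro u v huv
      refine Subtype.ext (Subtype.ext (Matrix.ext fun i j => ?_))
      by_cases hle : (lowerPoset D).le i j
      · rcases hle with rfl | ⟨h, hD⟩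
        · rw [u.1.2.1, v.1.2.1]
        · exact congrFun huv ⟨⟨i, j, h⟩, hD⟩
      · rw [u.2.2 i j hle, v.2.2 i j hle]
    · intro x
      let a : Matrix A A F := fun i j =>
        if i = j then 1 else if h : ∃ h : R.lt i j, (⟨i, j, h⟩ : IntO R) ∉ D then
          x ⟨⟨i, j, h.1⟩, h.2⟩ else 0
      have ha : a ∈ utSubmonoid F (lowerPoset D) := by
        refine ⟨fun i => if_pos rfl, fun i j hij => ?_⟩
        change (if i = j then 1 else _) = 0
        rw [if_neg fun h => hij (Or.inl h), dif_neg fun h => hij (Or.inr h)]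
      refine ⟨⟨⟨a, ha.1, fun i j hij => ha.2 i j fun h => hij (le_of_lowerPoset_le h)⟩, ha⟩, ?_⟩
      funext p
      change (if p.1.left = p.1.right then 1 else _) = _
      rw [if_neg p.1.lt.ne, dif_pos ⟨p.1.lt, p.2⟩]
  rw [Nat.card_congr (Equiv.ofBijective f hf), Nat.card_fun, Finset.prod_ite, Finset.prod_const_one,
    one_mul, Finset.prod_const, Nat.card_eq_fintype_card (α := {p // p ∉ D}), Fintype.card_subtype]

end NormalPattern

end PatternGroup

namespace PatternGroup

/-! ### Blocks of characters and the product formula -/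

section Blocks

variable {A : Type*} [Fintype A] [DecidableEq A] {F : Type*} [Field F] [Finite F]
  {R : PartialOrder A}

theorem mem_compl_Ici {P : Type*} [Preorder P] {p q : P} :
    q ∈ (UpperSet.Ici p).compl ↔ ¬ p ≤ q := Iff.rfl

/-- The complement of the principal up-set at p is the largest down-set avoiding p. -/
theorem LowerSet.le_compl_Ici {P : Type*} [Preorder P] {L : LowerSet P} {p : P} :
    L ≤ (UpperSet.Ici p).compl ↔ p ∉ L :=
  ⟨fun h hp => h hp le_rfl, fun h _ hq hpq => h (L.lower hpq hq)⟩

/-- The down-set attached to a character: the complement of the pattern of the largest normal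
pattern subgroup in its kernel. -/
def charLower (ψ : UT F R → ℂ) : LowerSet (IntO R) where
  carrier := {p | ¬ (normalPattern F (UpperSet.Ici p).compl : Set (UT F R)) ⊆ charKer ψ}
  lower' p q hqp hp hq := by
    have h : (UpperSet.Ici q).compl ≤ (UpperSet.Ici p).compl :=
      fun r hr hpr => hr (Set.mem_Ici.2 (hqp.trans (Set.mem_Ici.1 hpr)))
    exact hp (Set.Subset.trans (normalPattern_anti h) hq)

/-- D is the intersection of the largest down-sets avoiding p, over p ∉ D. If `charLower ψ ≤ D`, the
subgroup of each lies in the kernel, hence so does their join, which contains the subgroup of D. -/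
theorem charLower_le_iff {ψ : UT F R → ℂ} (hψ : ψ ∈ irr (UT F R)) {D : LowerSet (IntO R)} :
    charLower ψ ≤ D ↔ (normalPattern F D : Set (UT F R)) ⊆ charKer ψ := by
  classical
  constructor
  · intro h
    have key : ∀ s : Finset (IntO R),
        (∀ p ∈ s, (normalPattern F (UpperSet.Ici p).compl : Set (UT F R)) ⊆ charKer ψ) →
        (normalPattern F (s.inf fun p => (UpperSet.Ici p).compl) : Set (UT F R)) ⊆ charKer ψ := by
      intro s
      induction s using Finset.induction_on with
      | empty =>
        intro _ u hu
        have h1 : u = 1 := by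
          refine Subtype.ext (sub_eq_zero.1 (Matrix.ext fun i j => ?_))
          by_contra hne
          obtain ⟨_, h2⟩ := mem_normalPattern_iff_supportedOff.1 hu i j hne
          exact h2 trivial
        rw [h1]
        rfl
      | insert p s _ ih =>
        intro hs
        rw [Finset.inf_insert]
        refine Set.Subset.trans (normalPattern_inf_le _ _) (sup_subset_charKer hψ
          (hs p (Finset.mem_insert_self p s))
          (ih fun q hq => hs q (Finset.mem_insert_of_mem hq)))
    refine Set.Subset.trans (normalPattern_anti ?_) (key {p | p ∉ D} fun p hp => ?_)
    · intro q hq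
      by_contra hqD
      have hmem : q ∈ (Finset.univ.filter fun p => p ∉ D) := by simpa using hqD
      exact LowerSet.le_compl_Ici.1
        (Finset.inf_le (f := fun p => (UpperSet.Ici p).compl) hmem) hq
    · have hpD : p ∉ D := by simpa using hp
      exact not_not.1 fun hcon => hpD (h hcon)
  · intro h p hp
    by_contra hpD
    exact hp (Set.Subset.trans (normalPattern_anti (LowerSet.le_compl_Ici.2 hpD)) h)

/-- If `charLower ψ` were strictly below D, some down-set covered by D would still contain it, and
its subgroup would be a cover inside the kernel. -/
theorem charBlock_normalPattern (D : LowerSet (IntO R)) :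
    charBlock (NPtt F R) (normalPattern F D) = {ψ | ψ ∈ irr (UT F R) ∧ charLower ψ = D} := by
  ext ψ
  refine and_congr_right fun hψ => ?_
  rw [← charLower_le_iff hψ]
  constructor
  · rintro ⟨hle, hcov⟩
    by_contra hne
    obtain ⟨D', hD', hcovBy⟩ := exists_le_covBy_of_lt (lt_of_le_of_ne hle hne)
    refine hcov (normalPattern F D') ⟨mem_NPtt.2 ⟨D', rfl⟩,
      normalPattern_lt_iff.2 hcovBy.lt, ?_⟩ ((charLower_le_iff hψ).1 hD')
    intro K hK hlt hle'
    obtain ⟨E, rfl⟩ := mem_NPtt.1 hK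
    rw [normalPattern_lt_iff] at hlt
    rw [normalPattern_le_iff] at hle'
    rw [eq_of_le_of_not_lt hle' fun h => hcovBy.2 h hlt]
  · rintro rfl
    refine ⟨le_rfl, ?_⟩
    rintro O ⟨hO, hlt, -⟩ hsub
    obtain ⟨E, rfl⟩ := mem_NPtt.1 hO
    rw [normalPattern_lt_iff] at hlt
    exact hlt.not_ge ((charLower_le_iff hψ).2 hsub)

open Classical in
/-- The sum of the `ψ(1) ψ` over the irreducible characters `ψ` whose down-set lies between
`T` and `D`. -/
noncomputable def blockSum (D : LowerSet (IntO R)) (T : Set (IntO R)) (u : UT F R) : ℂ :=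
  ∑ ψ ∈ (finite_irr (UT F R)).toFinset,
    if charLower ψ ≤ D ∧ T ⊆ charLower ψ then ψ 1 * ψ u else 0

open Classical in
/-- The factor of the value of `blockSum D T` at the interval `p`, for the entry `x` there. -/
noncomputable def blockFactor (D : LowerSet (IntO R)) (T : Set (IntO R)) (p : IntO R)
    (x : F) : ℂ :=
  if p ∈ D then (if x = 0 then (Nat.card F : ℂ) else 0) - (if p ∈ T then 1 else 0) else 1

open Classical in
-- This is the inflated regular character of the quotient by `normalPattern F D`, a subgroup of
-- index q^|D|.
theorem blockSum_empty (D : LowerSet (IntO R)) (u : UT F R) :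
    blockSum D ∅ u = ∏ p : IntO R, blockFactor D ∅ p (u.1 p.left p.right) := by
  have h1 : blockSum D ∅ u =
      if u ∈ normalPattern F D then (Nat.card (UT F R) : ℂ) / Nat.card (normalPattern F D)
        else 0 := by
    rw [← sum_irr_filter_one_mul, Finset.sum_filter]
    refine Finset.sum_congr rfl fun ψ hψ => ?_
    rw [charLower_le_iff ((finite_irr _).mem_toFinset.1 hψ)]
    simp
  rw [h1]
  simp only [blockFactor, Set.mem_empty_iff_false, if_false, sub_zero]
  split_ifs with hu
  · rw [mem_normalPattern] at hu
    have hN : (Nat.card (normalPattern F D) : ℂ) ≠ 0 := Nat.cast_ne_zero.2 Nat.card_pos.ne'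
    have hG : Nat.card (UT F R) = ∏ p : IntO R, Nat.card F := by
      have h2 := card_normalPattern (F := F) (⊥ : LowerSet (IntO R))
      have h3 : normalPattern F (⊥ : LowerSet (IntO R)) = ⊤ :=
        eq_top_iff.2 fun v _ => mem_normalPattern.2 fun p hp => absurd hp LowerSet.notMem_bot
      rw [h3, Nat.card_congr Subgroup.topEquiv.toEquiv] at h2
      simpa using h2
    rw [div_eq_iff hN, hG, card_normalPattern, Nat.cast_prod, Nat.cast_prod,
      ← Finset.prod_mul_distrib]
    refine Finset.prod_congr rfl fun p _ => ?_
    by_cases hp : p ∈ D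
    · simp [hp, hu p hp]
    · simp [hp]
  · rw [mem_normalPattern] at hu
    push Not at hu
    obtain ⟨p, hp, hne⟩ := hu
    rw [eq_comm]
    exact Finset.prod_eq_zero (Finset.mem_univ p) (by rw [if_pos hp, if_neg hne])

/-- Inclusion-exclusion: the terms to discard are those whose down-set avoids p. -/
theorem blockSum_insert (D : LowerSet (IntO R)) (T : Set (IntO R)) (p : IntO R) (u : UT F R) :
    blockSum D (insert p T) u =
      blockSum D T u - blockSum (D ⊓ (UpperSet.Ici p).compl) T u := by
  classical
  rw [blockSum, blockSum, blockSum, ← Finset.sum_sub_distrib]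
  refine Finset.sum_congr rfl fun ψ _ => ?_
  rw [le_inf_iff, LowerSet.le_compl_Ici, Set.insert_subset_iff, SetLike.mem_coe]
  by_cases h1 : charLower ψ ≤ D <;> by_cases h2 : p ∈ charLower ψ <;>
    by_cases h3 : T ⊆ charLower ψ <;> simp [h1, h2, h3]

/-- Induction on T. As p is maximal in D, cutting away the intervals above p removes only p itself,
so the two products in `blockSum_insert` differ only in the factor at p, which is q[x = 0] for D and
1 for D without p. -/
theorem blockSum_eq_prod (T : Set (IntO R)) (D : LowerSet (IntO R))
    (hT : ∀ p ∈ T, Maximal (· ∈ D) p) (u : UT F R) :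
    blockSum D T u = ∏ p : IntO R, blockFactor D T p (u.1 p.left p.right) := by
  classical
  induction T, T.toFinite using Set.Finite.induction_on generalizing D with
  | empty => exact blockSum_empty D u
  | @insert p T hpT _ ih =>
    have hp := hT p (Set.mem_insert p T)
    have hmem : ∀ q, q ∈ D ⊓ (UpperSet.Ici p).compl ↔ q ∈ D ∧ q ≠ p := by
      intro q
      refine and_congr_right fun hq => ?_
      refine Iff.trans mem_compl_Ici ?_
      exact not_congr ⟨fun h => le_antisymm (hp.2 hq h) h, fun h => h.ge⟩
    have hT' : ∀ q ∈ T, Maximal (· ∈ D ⊓ (UpperSet.Ici p).compl) q := by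
      intro q hq
      have hqD := hT q (Set.mem_insert_of_mem p hq)
      refine ⟨(hmem q).2 ⟨hqD.1, ?_⟩, fun r hr => hqD.2 ((hmem r).1 hr).1⟩
      rintro rfl
      exact hpT hq
    rw [blockSum_insert, ih D fun q hq => hT q (Set.mem_insert_of_mem p hq), ih _ hT',
      ← Finset.mul_prod_erase _ _ (Finset.mem_univ p),
      ← Finset.mul_prod_erase _ (fun p => blockFactor (D ⊓ _) _ p _) (Finset.mem_univ p),
      ← Finset.mul_prod_erase _ (fun p => blockFactor _ (insert _ _) p _) (Finset.mem_univ p)]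
    have h1 : ∀ q ∈ Finset.univ.erase p,
        blockFactor (D ⊓ (UpperSet.Ici p).compl) T q (u.1 q.left q.right) =
          blockFactor D T q (u.1 q.left q.right) := by
      intro q hq
      simp only [blockFactor, hmem, ne_eq, Finset.ne_of_mem_erase hq, not_false_eq_true, and_true]
    have h2 : ∀ q ∈ Finset.univ.erase p,
        blockFactor D (insert p T) q (u.1 q.left q.right) =
          blockFactor D T q (u.1 q.left q.right) := by
      intro q hq
      simp only [blockFactor, Set.mem_insert_iff, Finset.ne_of_mem_erase hq, false_or]
    rw [Finset.prod_congr rfl h1, Finset.prod_congr rfl h2, ← sub_mul]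
    congr 1
    have hpD : p ∈ D := hp.1
    simp [blockFactor, hmem, hpD, hpT]

theorem maximal_of_mem_antichain {P : Type*} [PartialOrder P] {T : Set P}
    (hT : IsAntichain (· ≤ ·) T) {p : P} (hp : p ∈ T) : Maximal (· ∈ lowerClosure T) p := by
  refine ⟨subset_lowerClosure hp, ?_⟩
  rintro q ⟨r, hr, hqr⟩ hpq
  rwa [hT.eq hp hr (hpq.trans hqr)]

open Classical in
theorem chi_eq_sum (lam : PPnn R) (u : UT F R) :
    chi F lam u = ∑ ψ ∈ (finite_irr (UT F R)).toFinset,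
      if charLower ψ = lowerClosure lam.1 then ψ 1 * ψ u else 0 := by
  have h : charBlock (NPtt F R) (normalPattern F (lowerClosure lam.1)) =
      ↑((finite_irr (UT F R)).toFinset.filter fun ψ => charLower ψ = lowerClosure lam.1) := by
    rw [charBlock_normalPattern]
    ext ψ
    simp
  rw [chi, UTlam_eq_normalPattern, superchar, h, finsum_mem_coe_finset, Finset.sum_apply,
    Finset.sum_filter]
  rfl

theorem chi_eq_blockSum (lam : PPnn R) (u : UT F R) :
    chi F lam u = blockSum (lowerClosure lam.1) lam.1 u := by
  classical
  rw [chi_eq_sum, blockSum]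
  refine Finset.sum_congr rfl fun ψ _ => ?_
  have h : charLower ψ = lowerClosure lam.1 ↔
      charLower ψ ≤ lowerClosure lam.1 ∧ lam.1 ⊆ charLower ψ := by
    rw [← lowerClosure_le]
    exact le_antisymm_iff
  exact if_congr h rfl rfl

theorem chi_eq_prod (lam : PPnn R) (u : UT F R) :
    chi F lam u =
      ∏ p : IntO R, blockFactor (lowerClosure lam.1) lam.1 p (u.1 p.left p.right) := by
  rw [chi_eq_blockSum, blockSum_eq_prod _ _ fun p hp => maximal_of_mem_antichain lam.2 hp]

open Classical in
/-- The degree of a block, multiplied by the order of the normal pattern subgroup, depends only on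
the set of maximal intervals. -/
theorem card_normalPattern_mul_prod (D : LowerSet (IntO R)) (T : Set (IntO R))
    (hT : T ⊆ D) :
    (Nat.card (normalPattern F D) : ℂ) * ∏ p : IntO R, blockFactor D T p (0 : F) =
      ∏ p : IntO R, ((Nat.card F : ℂ) - if p ∈ T then 1 else 0) := by
  rw [card_normalPattern, Nat.cast_prod, ← Finset.prod_mul_distrib]
  refine Finset.prod_congr rfl fun p _ => ?_
  by_cases hp : p ∈ D
  · simp [blockFactor, hp]
  · have hpT : p ∉ T := fun h => hp (hT h)
    simp [blockFactor, hp, hpT]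

omit [DecidableEq A] in
-- Each factor is q, q - 1 or 1, and q ≥ 2.
theorem prod_blockFactor_zero_ne_zero (D : LowerSet (IntO R)) (T : Set (IntO R)) :
    ∏ p : IntO R, blockFactor D T p (0 : F) ≠ 0 := by
  refine Finset.prod_ne_zero_iff.2 fun p _ => ?_
  have h1 : (Nat.card F : ℂ) ≠ 1 := by exact_mod_cast Finite.one_lt_card.ne'
  have h2 : (Nat.card F : ℂ) - 1 ≠ 0 := sub_ne_zero.2 h1
  have h3 : (Nat.card F : ℂ) ≠ 0 := Nat.cast_ne_zero.2 Nat.card_pos.ne'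
  rw [blockFactor]
  split_ifs <;> simp_all

theorem chi_one (lam : PPnn R) :
    chi F lam 1 = ∏ p : IntO R, blockFactor (lowerClosure lam.1) lam.1 p (0 : F) := by
  let _ := R
  rw [chi_eq_prod]
  refine Finset.prod_congr rfl fun p _ => ?_
  congr 1
  exact Matrix.one_apply_ne p.lt.ne

end Blocks

/-! ### Restricted down-sets and the sum over antichains -/

section Restriction

variable {A C : Type*} {R : PartialOrder C}

/-- The proper intervals of the restriction of `R` along `f` in a down-set of proper intervals
of `R`. -/
def restrLower (f : A ↪ C) (D : LowerSet (IntO R)) : LowerSet (IntO (restr R f)) where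
  carrier := {p | p.incl ∈ D}
  lower' _ _ hqp hp := D.lower (IntO.map_le_map.2 hqp) hp

/-- Permits `blockSum_eq_prod` with T = λ_A, although λ_A need not generate the restricted down-set.
-/
theorem maximal_restrLower (f : A ↪ C) (lam : PPnn R) {p : IntO (restr R f)}
    (hp : p ∈ (restrPP f lam).1) : Maximal (· ∈ restrLower f (lowerClosure lam.1)) p :=
  ⟨subset_lowerClosure hp, fun _ hq hpq => IntO.map_le_map.1
    ((maximal_of_mem_antichain lam.2 hp).2 hq (IntO.map_le_map.2 hpq))⟩

/-- An interval fails to lie in every cut poset exactly when it is below a member of the partition,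
so the set is a difference of two down-sets. -/
theorem mem_intBetween {f : A ↪ C} {lam : PPnn R} {mu : PPnn (restr R f)}
    {p : IntO (restr R f)} :
    p ∈ intBetween f lam mu ↔
      p ∉ lowerClosure mu.1 ∧ p ∈ restrLower f (lowerClosure lam.1) := by
  refine and_congr ?_ ?_
  · constructor
    · rintro h ⟨q, hq, hpq⟩
      obtain ⟨_, h2⟩ := h q hq
      exact h2 hpq
    · exact fun h k hk => ⟨p.lt, fun hcon => h ⟨k, hk, hcon⟩⟩
  · constructor
    · intro h
      by_contra hcon
      exact h fun k hk => ⟨p.incl.lt, fun hle => hcon ⟨k, hk, hle⟩⟩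
    · rintro ⟨q, hq, hpq⟩ h
      obtain ⟨_, h2⟩ := h q hq
      exact h2 hpq

theorem mem_of_maximal_lowerClosure {P : Type*} [PartialOrder P] {T : Set P} {p : P}
    (hp : Maximal (· ∈ lowerClosure T) p) : p ∈ T := by
  obtain ⟨q, hq, hpq⟩ := hp.1
  rwa [le_antisymm hpq (hp.2 (subset_lowerClosure hq) hpq)]

theorem lowerClosure_injOn_antichain {P : Type*} [PartialOrder P] {S T : Set P}
    (hS : IsAntichain (· ≤ ·) S) (hT : IsAntichain (· ≤ ·) T)
    (h : lowerClosure S = lowerClosure T) : S = T :=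
  Set.Subset.antisymm
    (fun _ hp => mem_of_maximal_lowerClosure (h ▸ maximal_of_mem_antichain hS hp))
    (fun _ hp => mem_of_maximal_lowerClosure (h ▸ maximal_of_mem_antichain hT hp))

/-- The closure determines the antichain λ_A ∪ ν, and ν is recovered from it because the intervals
of ν avoid the closure of λ_A. -/
theorem unionAnti_injective (f : A ↪ C) (lam : PPnn R) :
    Function.Injective fun nu => lowerClosure (unionAnti f lam nu).1 := by
  intro nu eta h
  have h1 : (unionAnti f lam nu).1 = (unionAnti f lam eta).1 :=
    lowerClosure_injOn_antichain (unionAnti f lam nu).2 (unionAnti f lam eta).2 h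
  have h2 : ∀ nu, ∀ p : intBetween f lam (restrPP f lam),
      p ∈ nu.1 ↔ p.1 ∈ (unionAnti f lam nu).1 := by
    intro nu p
    refine ⟨fun hp => Or.inr ⟨p, hp, rfl⟩, ?_⟩
    rintro (hp | ⟨q, hq, hqp⟩)
    · exact absurd (subset_lowerClosure hp) (mem_intBetween.1 p.2).1
    · rwa [← Subtype.ext hqp]
  refine Subtype.ext (Set.ext fun p => ?_)
  rw [h2, h2, h1]

/-- Take ν to be the maximal elements of L in `intBetween`. A maximal element of L outside λ_A
cannot lie below a member of λ_A ⊆ L, so it does belong to `intBetween`. -/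
theorem exists_lowerClosure_unionAnti_iff [Finite A] (f : A ↪ C) (lam : PPnn R)
    {L : LowerSet (IntO (restr R f))} :
    (∃ nu, L = lowerClosure (unionAnti f lam nu).1) ↔
      L ≤ restrLower f (lowerClosure lam.1) ∧ (restrPP f lam).1 ⊆ L := by
  constructor
  · rintro ⟨nu, rfl⟩
    refine ⟨lowerClosure_le.2 ?_, fun p hp => subset_lowerClosure (Or.inl hp)⟩
    rintro p (hp | ⟨p, -, rfl⟩)
    · exact (maximal_restrLower f lam hp).1
    · exact (mem_intBetween.1 p.2).2
  · rintro ⟨hL, hsub⟩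
    have hanti : IsAntichain (· ≤ ·)
        {p : intBetween f lam (restrPP f lam) | Maximal (· ∈ L) p.1} := by
      intro p hp q hq hne hle
      exact hne (Subtype.ext (le_antisymm hle (hp.2 hq.1 hle)))
    refine ⟨⟨_, hanti⟩, le_antisymm (fun p hp => ?_) (lowerClosure_le.2 ?_)⟩
    · obtain ⟨q, hpq, hq⟩ := (Set.toFinite (L : Set (IntO (restr R f)))).exists_le_maximal hp
      refine ⟨q, ?_, hpq⟩
      by_cases hqm : q ∈ (restrPP f lam).1
      · exact Or.inl hqm
      · refine Or.inr ⟨⟨q, mem_intBetween.2 ⟨?_, hL hq.1⟩⟩, hq, rfl⟩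
        rintro ⟨r, hr, hqr⟩
        exact hqm (le_antisymm hqr (hq.2 (hsub hr) hqr) ▸ hr)
    · rintro p (hp | ⟨p, hp, rfl⟩)
      · exact hsub hp
      · exact hp.1

/-- Each ψ with λ_A ⊆ `charLower ψ` ⊆ the restricted down-set occurs for exactly one ν, so the sum
is a `blockSum`. -/
theorem sum_chi_unionAnti [Fintype A] [DecidableEq A] {F : Type*} [Field F] [Finite F]
    (f : A ↪ C) (lam : PPnn R) (u : UT F (restr R f)) :
    ∑ nu, chi F (unionAnti f lam nu) u =
      ∏ p : IntO (restr R f), blockFactor (restrLower f (lowerClosure lam.1))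
        (restrPP f lam).1 p (u.1 p.left p.right) := by
  classical
  rw [← blockSum_eq_prod _ _ fun p hp => maximal_restrLower f lam hp, blockSum]
  simp_rw [chi_eq_sum]
  rw [Finset.sum_comm]
  refine Finset.sum_congr rfl fun ψ _ => ?_
  simp_rw [← exists_lowerClosure_unionAnti_iff]
  split_ifs with h
  · obtain ⟨nu, hnu⟩ := h
    rw [Finset.sum_eq_single nu, if_pos hnu]
    · exact fun eta _ hne => if_neg fun h => hne (unionAnti_injective f lam (h.symm.trans hnu))
    · exact fun h => absurd (Finset.mem_univ _) h
  · exact Finset.sum_eq_zero fun nu _ => if_neg fun h' => h ⟨nu, h'⟩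

end Restriction

end PatternGroup

namespace PatternGroup

/-! ### Posets on a disjoint union: inflation and restriction -/

section Sums

variable {A B : Type*} {R : PartialOrder (A ⊕ B)} {P : PartialOrder A} {Q : PartialOrder B}

/-- The proper intervals of a poset on a disjoint union with one endpoint in each part. -/
def IntO.IsMixed (p : IntO R) : Prop := p.left.isLeft ≠ p.right.isLeft

open Classical in
/-- A product over the intervals of a poset on `A ⊕ B` splits into the products over the intervals
in `A`, in `B`, and over the mixed intervals. -/
theorem prod_intO_sum [Fintype A] [Fintype B]
    (hP : ∀ i j : A, R.le (Sum.inl i) (Sum.inl j) ↔ P.le i j)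
    (hQ : ∀ i j : B, R.le (Sum.inr i) (Sum.inr j) ↔ Q.le i j) (g : IntO R → ℂ) :
    ∏ p : IntO R, g p = (∏ p : IntO P, g (IntO.map Sum.inl hP p)) *
      (∏ p : IntO Q, g (IntO.map Sum.inr hQ p)) * ∏ p : {p : IntO R // p.IsMixed}, g p := by
  let e : (IntO P ⊕ IntO Q) ⊕ {p : IntO R // p.IsMixed} → IntO R :=
    Sum.elim (Sum.elim (IntO.map Sum.inl hP) (IntO.map Sum.inr hQ)) Subtype.val
  have he : Function.Bijective e := by
    constructor
    · rintro ((p | p) | ⟨p, hp⟩) ((q | q) | ⟨q, hq⟩) h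
      · have h1 := Sum.inl_injective (congrArg IntO.left h)
        have h2 := Sum.inl_injective (congrArg IntO.right h)
        rw [IntO.ext h1 h2]
      · exact absurd (congrArg IntO.left h) Sum.inl_ne_inr
      · subst h
        exact absurd rfl hq
      · exact absurd (congrArg IntO.left h) Sum.inr_ne_inl
      · have h1 := Sum.inr_injective (congrArg IntO.left h)
        have h2 := Sum.inr_injective (congrArg IntO.right h)
        rw [IntO.ext h1 h2]
      · subst h
        exact absurd rfl hq
      · subst h
        exact absurd rfl hp
      · subst h
        exact absurd rfl hp
      · have h' : p = q := h
        subst h'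
        rfl
    · rintro ⟨i | i, j | j, h⟩
      · have hlt := (R.lt_iff_le_not_ge _ _).1 h
        exact ⟨Sum.inl (Sum.inl ⟨i, j, (P.lt_iff_le_not_ge _ _).2
          ⟨(hP _ _).1 hlt.1, fun h' => hlt.2 ((hP _ _).2 h')⟩⟩), rfl⟩
      · exact ⟨Sum.inr ⟨⟨_, _, h⟩, Bool.noConfusion⟩, rfl⟩
      · exact ⟨Sum.inr ⟨⟨_, _, h⟩, Bool.noConfusion⟩, rfl⟩
      · have hlt := (R.lt_iff_le_not_ge _ _).1 h
        exact ⟨Sum.inl (Sum.inr ⟨i, j, (Q.lt_iff_le_not_ge _ _).2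
          ⟨(hQ _ _).1 hlt.1, fun h' => hlt.2 ((hQ _ _).2 h')⟩⟩), rfl⟩
  rw [← Fintype.prod_bijective e he (fun s => g (e s)) g fun _ => rfl, Fintype.prod_sum_type,
    Fintype.prod_sum_type]
  rfl

theorem blockFactor_congr {C C' F : Type*} [Field F] {R : PartialOrder C} {R' : PartialOrder C'}
    {D : LowerSet (IntO R)} {D' : LowerSet (IntO R')} {T : Set (IntO R)} {T' : Set (IntO R')}
    {p : IntO R} {p' : IntO R'} (hD : p ∈ D ↔ p' ∈ D') (hT : p ∈ T ↔ p' ∈ T') (x : F) :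
    blockFactor D T p x = blockFactor D' T' p' x := by
  by_cases h1 : p ∈ D <;> by_cases h2 : p ∈ T <;> simp [blockFactor, h1, h2, ← hD, ← hT]

/-- Serves both concatenation and disjoint union: with nothing of B below A, a mixed interval runs
from A to B and fits inside no interval of λ or ν, so its factor is 1. -/
theorem prod_blockFactor_union [Fintype A] [Fintype B] {F : Type*} [Field F] [Finite F]
    (hP : ∀ i j : A, R.le (Sum.inl i) (Sum.inl j) ↔ P.le i j)
    (hQ : ∀ i j : B, R.le (Sum.inr i) (Sum.inr j) ↔ Q.le i j)
    (hba : ∀ i j, ¬ R.le (Sum.inr j) (Sum.inl i)) (lam : Set (IntO P)) (nu : Set (IntO Q))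
    {S : Set (IntO R)} (hS : S = IntO.map Sum.inl hP '' lam ∪ IntO.map Sum.inr hQ '' nu)
    (x : A ⊕ B → A ⊕ B → F) :
    ∏ p : IntO R, blockFactor (lowerClosure S) S p (x p.left p.right) =
      (∏ p : IntO P, blockFactor (lowerClosure lam) lam p
        (x (Sum.inl p.left) (Sum.inl p.right))) *
      ∏ p : IntO Q, blockFactor (lowerClosure nu) nu p
        (x (Sum.inr p.left) (Sum.inr p.right)) := by
  classical
  subst hS
  rw [prod_intO_sum hP hQ,
    Finset.prod_eq_one (s := (Finset.univ : Finset {p : IntO R // p.IsMixed})), mul_one]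
  · congr 1
    · refine Finset.prod_congr rfl fun p _ => ?_
      have h1 : IntO.map Sum.inl hP p ∈ lowerClosure
          (IntO.map Sum.inl hP '' lam ∪ IntO.map Sum.inr hQ '' nu) ↔ p ∈ lowerClosure lam := by
        constructor
        · rintro ⟨_, ⟨q, hq, rfl⟩ | ⟨q, hq, rfl⟩, hle⟩
          · exact ⟨q, hq, IntO.map_le_map.1 hle⟩
          · exact absurd hle.1 (hba _ _)
        · rintro ⟨q, hq, hle⟩
          exact ⟨_, Or.inl ⟨q, hq, rfl⟩, IntO.map_le_map.2 hle⟩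
      have h2 : IntO.map Sum.inl hP p ∈
          (IntO.map Sum.inl hP '' lam ∪ IntO.map Sum.inr hQ '' nu) ↔ p ∈ lam := by
        constructor
        · rintro (⟨q, hq, h⟩ | ⟨q, hq, h⟩)
          · rwa [← IntO.ext (Sum.inl_injective (congrArg IntO.left h))
              (Sum.inl_injective (congrArg IntO.right h))]
          · exact absurd (congrArg IntO.left h) Sum.inr_ne_inl
        · exact fun h => Or.inl ⟨p, h, rfl⟩
      exact blockFactor_congr h1 h2 _
    · refine Finset.prod_congr rfl fun p _ => ?_
      have h1 : IntO.map Sum.inr hQ p ∈ lowerClosure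
          (IntO.map Sum.inl hP '' lam ∪ IntO.map Sum.inr hQ '' nu) ↔ p ∈ lowerClosure nu := by
        constructor
        · rintro ⟨_, ⟨q, hq, rfl⟩ | ⟨q, hq, rfl⟩, hle⟩
          · exact absurd hle.2 (hba _ _)
          · exact ⟨q, hq, IntO.map_le_map.1 hle⟩
        · rintro ⟨q, hq, hle⟩
          exact ⟨_, Or.inr ⟨q, hq, rfl⟩, IntO.map_le_map.2 hle⟩
      have h2 : IntO.map Sum.inr hQ p ∈
          (IntO.map Sum.inl hP '' lam ∪ IntO.map Sum.inr hQ '' nu) ↔ p ∈ nu := by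
        constructor
        · rintro (⟨q, hq, h⟩ | ⟨q, hq, h⟩)
          · exact absurd (congrArg IntO.left h) Sum.inl_ne_inr
          · rwa [← IntO.ext (Sum.inr_injective (congrArg IntO.left h))
              (Sum.inr_injective (congrArg IntO.right h))]
        · exact fun h => Or.inr ⟨p, h, rfl⟩
      exact blockFactor_congr h1 h2 _
  · rintro ⟨⟨i | i, j | j, h⟩, hm⟩ -
    · exact absurd rfl hm
    · refine if_neg ?_
      rintro ⟨_, ⟨q, hq, rfl⟩ | ⟨q, hq, rfl⟩, hle⟩
      · exact hba _ _ hle.2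
      · exact hba _ _ hle.1
    · exact absurd ((R.lt_iff_le_not_ge _ _).1 h).1 (hba _ _)
    · exact absurd rfl hm

open Classical in
/-- The values of `χ^lam` at matrices with zero entries at the mixed intervals. -/
theorem prod_blockFactor_restr [Fintype A] [Fintype B] {F : Type*} [Field F] (lam : PPnn R)
    (x : A ⊕ B → A ⊕ B → F)
    (hx : ∀ p : IntO R, p.IsMixed → x p.left p.right = 0) :
    ∏ p : IntO R, blockFactor (lowerClosure lam.1) lam.1 p (x p.left p.right) =
      (∏ p : IntO (restr R (Function.Embedding.inl : A ↪ A ⊕ B)),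
        blockFactor (restrLower _ (lowerClosure lam.1)) (restrPP _ lam).1 p
          (x (Sum.inl p.left) (Sum.inl p.right))) *
      (∏ p : IntO (restr R (Function.Embedding.inr : B ↪ A ⊕ B)),
        blockFactor (restrLower _ (lowerClosure lam.1)) (restrPP _ lam).1 p
          (x (Sum.inr p.left) (Sum.inr p.right))) *
      ∏ p : {p : IntO R // p.IsMixed}, blockFactor (lowerClosure lam.1) lam.1 p.1 (0 : F) := by
  rw [prod_intO_sum (P := restr R Function.Embedding.inl) (Q := restr R Function.Embedding.inr)
    (fun _ _ => Iff.rfl) (fun _ _ => Iff.rfl)]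
  congr 1
  exact Finset.prod_congr rfl fun p _ => by rw [hx p.1 p.2]

variable [Fintype A] [DecidableEq A] [Fintype B] [DecidableEq B] {F : Type*} [Field F]

theorem inclAB_injective : Function.Injective (inclAB (F := F) (R := R)) := by
  intro z w h
  have h1 : Matrix.fromBlocks z.1.1 0 0 z.2.1 = Matrix.fromBlocks w.1.1 0 0 w.2.1 :=
    congrArg Subtype.val h
  obtain ⟨h2, -, -, h3⟩ := Matrix.fromBlocks_inj.1 h1
  exact Prod.ext (Subtype.ext h2) (Subtype.ext h3)

variable [Finite F]

/-- Mixed entries of a block diagonal matrix vanish automatically. -/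
theorem inclAB_mem_normalPattern {D : LowerSet (IntO R)}
    {z : UT F (restr R (Function.Embedding.inl : A ↪ A ⊕ B)) ×
      UT F (restr R (Function.Embedding.inr : B ↪ A ⊕ B))} :
    inclAB z ∈ normalPattern F D ↔
      z.1 ∈ normalPattern F (restrLower Function.Embedding.inl D) ∧
        z.2 ∈ normalPattern F (restrLower Function.Embedding.inr D) := by
  simp only [mem_normalPattern]
  constructor
  · exact fun h => ⟨fun p hp => h p.incl hp, fun p hp => h p.incl hp⟩
  · rintro ⟨h1, h2⟩ ⟨i | i, j | j, h⟩ hp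
    · exact h1 ⟨i, j, (R.lt_iff_le_not_ge _ _).1 h⟩ hp
    · rfl
    · rfl
    · exact h2 ⟨i, j, (R.lt_iff_le_not_ge _ _).1 h⟩ hp

theorem card_inter_range_inclAB (D : LowerSet (IntO R)) :
    Nat.card ↥((normalPattern F D : Set (UT F R)) ∩ Set.range inclAB) =
      Nat.card (normalPattern F (restrLower (Function.Embedding.inl : A ↪ A ⊕ B) D)) *
        Nat.card (normalPattern F (restrLower (Function.Embedding.inr : B ↪ A ⊕ B) D)) := by
  have h : (normalPattern F D : Set (UT F R)) ∩ Set.range inclAB = inclAB ''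
      ((normalPattern F (restrLower (Function.Embedding.inl : A ↪ A ⊕ B) D) : Set (UT F _)) ×ˢ
        (normalPattern F (restrLower (Function.Embedding.inr : B ↪ A ⊕ B) D) :
          Set (UT F _))) := by
    ext u
    constructor
    · rintro ⟨hu, z, rfl⟩
      exact ⟨z, inclAB_mem_normalPattern.1 hu, rfl⟩
    · rintro ⟨z, hz, rfl⟩
      exact ⟨inclAB_mem_normalPattern.2 hz, z, rfl⟩
  rw [h, Nat.card_image_of_injective inclAB_injective, Nat.card_congr (Equiv.Set.prod _ _),
    Nat.card_prod]
  rfl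

theorem Inf_chi_tmul_chi (lam : PPnn P) (nu : PPnn Q) :
    PatternGroup.Inf P Q (chi F lam ⊗ₜ[ℂ] chi F nu) = chi F (unionConcat lam nu) := by
  funext u
  change tensorEquiv (UT F P) (UT F Q) (chi F lam ⊗ₜ[ℂ] chi F nu) (projAB u) = _
  rw [tensorEquiv_tmul, chi_eq_prod, chi_eq_prod, chi_eq_prod]
  exact (prod_blockFactor_union (R := concat P Q) (fun _ _ => Iff.rfl) (fun _ _ => Iff.rfl)
    (fun _ _ h => h) lam.1 nu.1 rfl u.1).symm

theorem chi_unionDisj_one (lam : PPnn P) (nu : PPnn Q) :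
    chi F (unionDisj lam nu) 1 = chi F lam 1 * chi F nu 1 := by
  rw [chi_one, chi_one, chi_one]
  exact prod_blockFactor_union (R := disjUnion P Q) (fun _ _ => Iff.rfl) (fun _ _ => Iff.rfl)
    (fun _ _ h => h) lam.1 nu.1 rfl fun _ _ => 0

theorem Res_chi (lam : PPnn R) :
    Res R (chi F lam) =
      ((Nat.card ↥((UTlam F lam : Set (UT F R)) ∩ Set.range inclAB) : ℂ) /
          (Nat.card (UTlam F (restrPP Function.Embedding.inl lam) ×
            UTlam F (restrPP Function.Embedding.inr lam)) : ℂ) *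
        (chi F lam 1 /
          chi F (unionDisj (restrPP Function.Embedding.inl lam)
            (restrPP Function.Embedding.inr lam)) 1)) •
      ∑ nu : Anti (intBetween Function.Embedding.inl lam
          (restrPP Function.Embedding.inl lam)),
        ∑ eta : Anti (intBetween Function.Embedding.inr lam
            (restrPP Function.Embedding.inr lam)),
          chi F (unionAnti Function.Embedding.inl lam nu) ⊗ₜ[ℂ]
            chi F (unionAnti Function.Embedding.inr lam eta) := by
  classical
  change (tensorEquiv _ _).symm (fun z => chi F lam (inclAB z)) = _
  rw [LinearEquiv.symm_apply_eq]
  funext z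
  simp only [map_smul, map_sum, Pi.smul_apply, Finset.sum_apply, tensorEquiv_tmul, smul_eq_mul]
  rw [← Finset.sum_mul_sum, sum_chi_unionAnti, sum_chi_unionAnti, chi_eq_prod,
    prod_blockFactor_restr lam (inclAB z).1 ?_, Nat.card_prod, chi_unionDisj_one, chi_one lam,
    prod_blockFactor_restr lam (fun _ _ => (0 : F)) fun _ _ => rfl, chi_one, chi_one,
    UTlam_eq_normalPattern, UTlam_eq_normalPattern, UTlam_eq_normalPattern,
    card_inter_range_inclAB]
  -- The restricted down-set and the closure of λ_A share the marked set λ_A, so subgroup order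
  -- times value at 1 is the same for both.
  · have hA := (card_normalPattern_mul_prod (F := F)
      (restrLower (Function.Embedding.inl : A ↪ A ⊕ B) (lowerClosure lam.1)) (restrPP _ lam).1
      fun _ hp => (maximal_restrLower _ lam hp).1).trans
      (card_normalPattern_mul_prod (F := F) _ (restrPP _ lam).1 subset_lowerClosure).symm
    have hB := (card_normalPattern_mul_prod (F := F)
      (restrLower (Function.Embedding.inr : B ↪ A ⊕ B) (lowerClosure lam.1)) (restrPP _ lam).1
      fun _ hp => (maximal_restrLower _ lam hp).1).trans
      (card_normalPattern_mul_prod (F := F) _ (restrPP _ lam).1 subset_lowerClosure).symm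
    have hA0 := prod_blockFactor_zero_ne_zero (F := F)
      (lowerClosure (restrPP (Function.Embedding.inl : A ↪ A ⊕ B) lam).1) (restrPP _ lam).1
    have hB0 := prod_blockFactor_zero_ne_zero (F := F)
      (lowerClosure (restrPP (Function.Embedding.inr : B ↪ A ⊕ B) lam).1) (restrPP _ lam).1
    have hcA : (Nat.card (normalPattern F
        (lowerClosure (restrPP (Function.Embedding.inl : A ↪ A ⊕ B) lam).1)) : ℂ) ≠ 0 :=
      Nat.cast_ne_zero.2 Nat.card_pos.ne'
    have hcB : (Nat.card (normalPattern F
        (lowerClosure (restrPP (Function.Embedding.inr : B ↪ A ⊕ B) lam).1)) : ℂ) ≠ 0 :=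
      Nat.cast_ne_zero.2 Nat.card_pos.ne'
    -- Here nA, cA are the orders of the subgroups for the restricted down-set and for λ_A; a, dA
    -- are the corresponding products at zero entries (likewise for B). M is the mixed product, and
    -- X, Y are the products over the intervals in A and B at the given matrix.
    have key : ∀ nA nB a b cA cB dA dB M X Y : ℂ, nA * a = cA * dA → nB * b = cB * dB →
        cA ≠ 0 → cB ≠ 0 → dA ≠ 0 → dB ≠ 0 →
        X * Y * M = nA * nB / (cA * cB) * (a * b * M / (dA * dB)) * (X * Y) := by
      intro nA nB a b cA cB dA dB M X Y h1 h2 h3 h4 h5 h6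
      have h7 : nA * nB / (cA * cB) * (a * b * M / (dA * dB)) * (X * Y) =
          (nA * a) * (nB * b) / (cA * cB * (dA * dB)) * (X * Y * M) := by
        ring
      rw [h7, h1, h2, show cA * dA * (cB * dB) = cA * cB * (dA * dB) by ring, div_self, one_mul]
      exact mul_ne_zero (mul_ne_zero h3 h4) (mul_ne_zero h5 h6)
    rw [Nat.cast_mul, Nat.cast_mul]
    exact key _ _ _ _ _ _ _ _ _ _ _ hA hB hcA hcB hA0 hB0
  · rintro ⟨i | i, j | j, h⟩ hm
    · exact absurd rfl hm
    · rfl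
    · rfl
    · exact absurd rfl hm

end Sums

end PatternGroup

open PatternGroup in
theorem mainTheorem2 {A B : Type*} [Fintype A] [DecidableEq A] [Fintype B] [DecidableEq B]
    {F : Type*} [Field F] [Finite F] :
    (∀ (R : PartialOrder A) (Q : PartialOrder B) (lam : PPnn R) (nu : PPnn Q),
      PatternGroup.Inf R Q (chi F lam ⊗ₜ[ℂ] chi F nu) = chi F (unionConcat lam nu)) ∧
    (∀ (R : PartialOrder (A ⊕ B)) (lam : PPnn R),
      Res R (chi F lam) =
        ((Nat.card ↥((UTlam F lam : Set (UT F R)) ∩ Set.range inclAB) : ℂ) /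
            (Nat.card (UTlam F (restrPP Function.Embedding.inl lam) ×
              UTlam F (restrPP Function.Embedding.inr lam)) : ℂ) *
          (chi F lam 1 /
            chi F (unionDisj (restrPP Function.Embedding.inl lam)
              (restrPP Function.Embedding.inr lam)) 1)) •
        ∑ nu : Anti (intBetween Function.Embedding.inl lam
            (restrPP Function.Embedding.inl lam)),
          ∑ eta : Anti (intBetween Function.Embedding.inr lam
              (restrPP Function.Embedding.inr lam)),
            chi F (unionAnti Function.Embedding.inl lam nu) ⊗ₜ[ℂ]
              chi F (unionAnti Function.Embedding.inr lam eta)) := by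
  exact ⟨fun _ _ => Inf_chi_tmul_chi, fun _ => Res_chi⟩
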